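/- **Theorem.** The following six parameterized problems, each with parameter $k$, belong to the class $\mathsf{W[3]}$: \textsc{Grundy Domination}, \textsc{Total Grundy Domination}, \textsc{One-Sided Grundy Total Domination}, \textsc{L-Grundy Domination}, \textsc{Z-Grundy Domination}, and \textsc{Grundy Covering in Hypergraphs}. *The problems.* All graphs and hypergraphs are finite, graphs are simple, and isolated vertices are allowed. Let $N(v)$ be the open neighborhood of $v$ and $N[v]=N(v)\cup\{v\}$. A sequence $(v_1,\dots,v_\ell)$ of pairwise different vertices of a graph $G$ is a dominating sequence if $N[v_i]\setminus\bigcup_{j<i}N[v_j]\neq\emptyset$ for all $i$; a total dominating sequence if $N(v_i)\setminus\bigcup_{j<i}N(v_j)\neq\emptyset$ for all $i$; a $Z$-sequence if $N(v_i)\setminus\bigcup_{j<i}N[v_j]\neq\emptyset$ for all $i$; an $L$-sequence if $N[v_i]\setminus\bigcup_{j<i}N(v_j)\neq\emptyset$ for all $i$. Given $G$ and $k\in\mathbb N$, \textsc{Grundy Domination} (\textsc{Total Grundy}, \textsc{Z-Grundy}, \textsc{L-Grundy Domination}) asks whether $G$ has a dominating sequence (total dominating sequence, $Z$-sequence, $L$-sequence,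 respectively) of length at least $k$. Given a bipartite graph $G$ with bipartition $V(G)=A\mathbin{\dot\cup}B$ and $k\in\mathbb N$, \textsc{One-Sided Grundy Total Domination} asks whether $G$ has a total dominating sequence of length $k$ all of whose vertices lie in $A$. Given a hypergraph $\mathcal H=(X,\mathcal E)$ and $k\in\mathbb N$, \textsc{Grundy Covering in Hypergraphs} asks whether there is a sequence $(C_1,\dots,C_\ell)$ of edges of $\mathcal H$ with $\ell\ge k$ and $C_i\setminus\bigcup_{j<i}C_j\neq\emptyset$ for all $i$. *The class.* A parameterized problem is a language $L\subseteq\Sigma^*\times\mathbb N$; words that do not encode an input are no-instances. Graphs are encoded by adjacency matrices, hypergraphs by lists of characteristic vectors of their edges, and circuits by lists of their gates in topological order. An $\mathsf{FPT}$ reduction from $L_1$ to $L_2$ is a map $(x,k)\mapsto(x',k')$ with $(x,k)\in L_1\iff(x',k')\in L_2$, with $k'\le g(k)$ for some computable $g$, that a Turing machine computes in time $f(k)\cdot|(x,k)|^{O(1)}$ for some computable $f$. A Boolean circuit is a directed acyclic graph of AND and OR gates over input variables, where every gate input may be negated, with one output gate; a gate is large if it has more than four inputs. The depth (weft) of a circuit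 is the maximum number of gates (large gates) on a directed path that ends in the output. $\mathrm{WCS}[\mathcal C_{t,d}]$ asks, for a circuit of weft at most $t$ and depth at most $d$ and a parameter $k$, whether it has a satisfying assignment with exactly $k$ variables set to true. $L$ is in $\mathsf{W}[t]$ if for some fixed $d\ge1$ there is an $\mathsf{FPT}$ reduction from $L$ to $\mathrm{WCS}[\mathcal C_{t,d}]$. -/

import Mathlib

namespace GrundyW

/-! ### Sequences in graphs and hypergraphs -/

section Sequences

variable {V : Type*}

/-- The closed neighborhood `N[v]`. -/
def closedNbhd (G : SimpleGraph V) (v : V) : Set V := insert v (G.neighborSet v)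

/-- `σ = (v₁, …, vₗ)` consists of pairwise different vertices, and for every `i` the set
`N₁(vᵢ) \ ⋃_{j < i} N₂(vⱼ)` of vertices footprinted by `vᵢ` is nonempty. -/
def IsFootprintSeq (N₁ N₂ : V → Set V) {l : ℕ} (σ : Fin l → V) : Prop :=
  Function.Injective σ ∧ ∀ i : Fin l, (N₁ (σ i) \ ⋃ j : Fin l, ⋃ _ : j < i, N₂ (σ j)).Nonempty

def IsDominatingSeq (G : SimpleGraph V) {l : ℕ} (σ : Fin l → V) : Prop :=
  IsFootprintSeq (closedNbhd G) (closedNbhd G) σ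

def IsTotalDominatingSeq (G : SimpleGraph V) {l : ℕ} (σ : Fin l → V) : Prop :=
  IsFootprintSeq G.neighborSet G.neighborSet σ

def IsZSeq (G : SimpleGraph V) {l : ℕ} (σ : Fin l → V) : Prop :=
  IsFootprintSeq G.neighborSet (closedNbhd G) σ

def IsLSeq (G : SimpleGraph V) {l : ℕ} (σ : Fin l → V) : Prop :=
  IsFootprintSeq (closedNbhd G) G.neighborSet σ

def IsCoveringSeq (H : Hypergraph V) {l : ℕ} (C : Fin l → Set V) : Prop :=
  (∀ i, C i ∈ H.edgeSet) ∧ ∀ i : Fin l, (C i \ ⋃ j : Fin l, ⋃ _ : j < i, C j).Nonempty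

end Sequences

/-! ### Parameterized problems and FPT reductions -/

/-- A parameterized problem: a set of pairs of a word over the alphabet `Bool` and a parameter. -/
abbrev ParamProblem : Type := Set (List Bool × ℕ)

/-- The word that a machine gets for the instance `(x, k)`: the parameter in unary, written with
the extra symbol `none`, followed by `x`. Its length is `k + |x|`. -/
def instanceWord (p : List Bool × ℕ) : List (Option Bool) :=
  List.replicate p.2 none ++ p.1.map some

/-- The multi-stack Turing machine `M` computes `R` within `T p` steps on each instance `p`. -/
def ComputesInTime (M : Turing.TM2ComputableAux (Option Bool) (Option Bool))
    (R : List Bool × ℕ → List Bool × ℕ) (T : List Bool × ℕ → ℕ) : Prop :=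
  ∀ p, Nonempty (Turing.TM2OutputsInTime M.tm
    ((instanceWord p).map M.inputAlphabet.symm)
    (some ((instanceWord (R p)).map M.outputAlphabet.symm)) (T p))

/-- There is an FPT reduction from `L₁` to `L₂`. The time bound is `f(k) · |(x, k)|^{O(1)}`; the
summand `1` only serves the empty word. -/
def FPTReducible (L₁ L₂ : ParamProblem) : Prop :=
  ∃ R : List Bool × ℕ → List Bool × ℕ,
    (∀ p, p ∈ L₁ ↔ R p ∈ L₂) ∧
    (∃ g : ℕ → ℕ, Computable g ∧ ∀ p, (R p).2 ≤ g p.2) ∧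
    ∃ (M : Turing.TM2ComputableAux (Option Bool) (Option Bool)) (f : ℕ → ℕ) (c : ℕ),
      Computable f ∧ ComputesInTime M R (fun p => f p.2 * ((instanceWord p).length + 1) ^ c)

/-! ### Boolean circuits -/

/-- An AND gate (`isAnd = true`) or OR gate (`isAnd = false`). An input `(b, i)` is the node `i`,
negated if `b = true`. -/
structure Gate where
  isAnd : Bool
  inputs : List (Bool × ℕ)

/-- Large gates are those with more than four inputs. -/
def Gate.isLarge (g : Gate) : Bool := decide (4 < g.inputs.length)

/-- The value of a gate, given the values `v` of all nodes. -/
def Gate.value (g : Gate) (v : ℕ → Bool) : Bool :=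
  if g.isAnd then g.inputs.all (fun w => xor w.1 (v w.2))
  else g.inputs.any (fun w => xor w.1 (v w.2))

/-- A Boolean circuit, with its gates in topological order. The nodes `0, …, vars - 1` are the
input variables, and the node `vars + j` is the `j`-th gate. The output is the last gate. -/
structure Circuit where
  vars : ℕ
  gates : List Gate
  gates_ne_nil : gates ≠ []
  acyclic : ∀ (j : ℕ) (hj : j < gates.length), ∀ w ∈ (gates[j]).inputs, w.2 < vars + j

namespace Circuit

/-- The position of the output gate in the list of gates. -/
def outGate (C : Circuit) : ℕ := C.gates.length - 1

/-- `v` assigns to the nodes the values that they take under the assignment `a` of the input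
variables. -/
def IsValuation (C : Circuit) (a : Fin C.vars → Bool) (v : ℕ → Bool) : Prop :=
  (∀ i : Fin C.vars, v i = a i) ∧
    ∀ (j : ℕ) (hj : j < C.gates.length), v (C.vars + j) = (C.gates[j]).value v

def Satisfies (C : Circuit) (a : Fin C.vars → Bool) : Prop :=
  ∃ v : ℕ → Bool, C.IsValuation a v ∧ v (C.vars + C.outGate) = true

/-- There is a satisfying assignment with exactly `k` variables receiving the value `true`. -/
def HasSatWeight (C : Circuit) (k : ℕ) : Prop :=
  ∃ a : Fin C.vars → Bool, C.Satisfies a ∧ (Finset.univ.filter (fun i => a i = true)).card = k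

/-- Gate number `i` is an input of gate number `j`. -/
def Feeds (C : Circuit) (i j : Fin C.gates.length) : Prop :=
  ∃ w ∈ (C.gates[j]).inputs, w.2 = C.vars + i

/-- The list `p` consists of the gates on a directed path that ends in the output. Paths may start
at any gate, so gates without inputs count as well. -/
def IsPathToOutput (C : Circuit) (p : List (Fin C.gates.length)) : Prop :=
  p.IsChain C.Feeds ∧ ∃ o ∈ p.getLast?, (o : ℕ) = C.outGate

def DepthLE (C : Circuit) (d : ℕ) : Prop :=
  ∀ p, C.IsPathToOutput p → p.length ≤ d

def WeftLE (C : Circuit) (t : ℕ) : Prop :=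
  ∀ p, C.IsPathToOutput p → p.countP (fun j => (C.gates[j]).isLarge) ≤ t

end Circuit

/-! ### Encodings as words over `Bool` -/

/-- Self-delimiting unary encoding. -/
def encodeNat (n : ℕ) : List Bool := List.replicate n true ++ [false]

/-- Self-delimiting encoding of a list: every entry is preceded by `true`, the end is `false`. -/
def encodeList {α : Type*} (e : α → List Bool) (l : List α) : List Bool :=
  l.flatMap (fun a => true :: e a) ++ [false]

def Gate.encode (g : Gate) : List Bool :=
  g.isAnd :: encodeList (fun w : Bool × ℕ => w.1 :: encodeNat w.2) g.inputs

def Circuit.encode (C : Circuit) : List Bool :=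
  encodeNat C.vars ++ encodeList Gate.encode C.gates

open Classical in
/-- The characteristic vector of a subset of `{0, …, n - 1}`. -/
noncomputable def encodeSubset {n : ℕ} (S : Set (Fin n)) : List Bool :=
  List.ofFn (fun i => decide (i ∈ S))

/-- The number of vertices, followed by the rows of the adjacency matrix. -/
noncomputable def encodeGraph {n : ℕ} (G : SimpleGraph (Fin n)) : List Bool :=
  encodeNat n ++ (List.ofFn (fun i => encodeSubset (G.neighborSet i))).flatten

/-- A graph with a distinguished vertex set `A`. -/
noncomputable def encodeSidedGraph {n : ℕ} (G : SimpleGraph (Fin n)) (A : Set (Fin n)) :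
    List Bool :=
  encodeGraph G ++ encodeSubset A

/-- A hypergraph on `{0, …, n - 1}`, given by a list of its edges. -/
noncomputable def encodeHypergraph (n : ℕ) (E : List (Set (Fin n))) : List Bool :=
  encodeNat n ++ encodeList encodeSubset E

/-! ### The W-hierarchy -/

/-- Weighted circuit satisfiability for circuits of weft at most `t` and depth at most `d`. -/
def WCS (t d : ℕ) : ParamProblem :=
  {p | ∃ C : Circuit, p.1 = C.encode ∧ C.WeftLE t ∧ C.DepthLE d ∧ C.HasSatWeight p.2}

/-- The parameterized problem `L` belongs to the class `W[t]`. -/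
def InW (t : ℕ) (L : ParamProblem) : Prop :=
  ∃ d : ℕ, 1 ≤ d ∧ FPTReducible L (WCS t d)

/-! ### The problems -/

def GrundyDomination : ParamProblem :=
  {p | ∃ (n : ℕ) (G : SimpleGraph (Fin n)), p.1 = encodeGraph G ∧
    ∃ l, p.2 ≤ l ∧ ∃ σ : Fin l → Fin n, IsDominatingSeq G σ}

def TotalGrundyDomination : ParamProblem :=
  {p | ∃ (n : ℕ) (G : SimpleGraph (Fin n)), p.1 = encodeGraph G ∧
    ∃ l, p.2 ≤ l ∧ ∃ σ : Fin l → Fin n, IsTotalDominatingSeq G σ}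

def ZGrundyDomination : ParamProblem :=
  {p | ∃ (n : ℕ) (G : SimpleGraph (Fin n)), p.1 = encodeGraph G ∧
    ∃ l, p.2 ≤ l ∧ ∃ σ : Fin l → Fin n, IsZSeq G σ}

def LGrundyDomination : ParamProblem :=
  {p | ∃ (n : ℕ) (G : SimpleGraph (Fin n)), p.1 = encodeGraph G ∧
    ∃ l, p.2 ≤ l ∧ ∃ σ : Fin l → Fin n, IsLSeq G σ}

/-- The input is a bipartite graph with bipartition `V(G) = A ∪ Aᶜ`. The sequence has length
exactly `k`. -/
def OneSidedGrundyTotalDomination : ParamProblem :=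
  {p | ∃ (n : ℕ) (G : SimpleGraph (Fin n)) (A : Set (Fin n)), G.IsBipartiteWith A Aᶜ ∧
    p.1 = encodeSidedGraph G A ∧
    ∃ σ : Fin p.2 → Fin n, IsTotalDominatingSeq G σ ∧ ∀ i, σ i ∈ A}

def GrundyCoveringInHypergraphs : ParamProblem :=
  {p | ∃ (n : ℕ) (H : Hypergraph (Fin n)) (E : List (Set (Fin n))),
    H.vertexSet = Set.univ ∧ H.edgeSet = {e | e ∈ E} ∧ p.1 = encodeHypergraph n E ∧
    ∃ l, p.2 ≤ l ∧ ∃ C : Fin l → Set (Fin n), IsCoveringSeq H C}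

end GrundyW

/-! All six problems ask for `k` rows and `k` columns of a 0/1 matrix such that the `i`-th row meets
the `i`-th column, no earlier row does, and the rows are pairwise different (`HasSeq`). For graphs
this is the adjacency matrix, where a closed neighborhood adds the diagonal to the positive or to
the negative condition; for hypergraphs it is the incidence matrix. A prefix of a footprint sequence
is again one, so "length at least `k`" means the same as "length `k`".

Selecting rows and columns takes Boolean variables "row `r` is the `i`-th one" and "column `c` is
the `i`-th one", which form `2k` blocks. One long clause per block demands a true variable in it;
every other condition is a clause on at most two variables and one matrix entry. A sequence yields
an assignment with one true variable per block, hence of weight `2k`. Conversely, the short clauses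
restrict all combinations of true variables, so any choice of one true variable per block gives a
sequence (`hasSeq_iff`, `sat_seqCls`).

The bits of the instance enter the circuit as gates without inputs: an empty AND is true, an empty
OR is false. The circuit has three layers, constants, OR gates for the clauses and one AND gate, so
its depth, and with it its weft, is at most 3 (`mem_WCS_cnfGates`). Clauses on the constants reject
words of the right length that encode no input; words of a wrong length are sent to the empty word,
which encodes no circuit.

As the instance bits are merely copied, the clauses themselves depend only on a few sizes. The
reduction can therefore be written in a small language `Gen` with bounded loops, unary numbers and
comparisons of numbers. Its expressions are compiled to structured stack programs
(`Gen.runLE_compile`) and these to TM2 machines (`Prog.Run.reaches`), with a polynomial time bound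
(`Gen.fptReducible`). -/

namespace GrundyW

/-! ### Structured programs on stacks -/

/-- Structured programs that act on stacks indexed by `K` with symbols from `A`. -/
inductive Prog (K A : Type) : Type
  | skip : Prog K A
  | push : K → A → Prog K A
  | seq : Prog K A → Prog K A → Prog K A
  | pop : K → Prog K A → (A → Prog K A) → Prog K A
  | loop : K → (A → Prog K A) → Prog K A

namespace Prog

variable {K A : Type}

/-- `p.Run s s' t`: started with the stacks `s`, the program stops after `t` steps with `s'`. -/
inductive Run [DecidableEq K] : Prog K A → (K → List A) → (K → List A) → ℕ → Prop
  | skip (s) : Run skip s s 1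
  | push (s k a) : Run (push k a) s (Function.update s k (a :: s k)) 1
  | seq {p q s s' s'' t t'} : Run p s s' t → Run q s' s'' t' → Run (seq p q) s s'' (t + t')
  | pop_nil {k p q s s' t} : s k = [] → Run p s s' t → Run (pop k p q) s s' (t + 1)
  | pop_cons {k p q s s' t a l} : s k = a :: l → Run (q a) (Function.update s k l) s' t →
      Run (pop k p q) s s' (t + 1)
  | loop_nil {k q s} : s k = [] → Run (loop k q) s s 1
  | loop_cons {k q s s' s'' t t' a l} : s k = a :: l → Run (q a) (Function.update s k l) s' t →
      Run (loop k q) s' s'' t' → Run (loop k q) s s'' (t + t' + 1)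

/-- The control points of a program. -/
def Lab : Prog K A → Type
  | skip => Unit
  | push _ _ => Unit
  | seq p q => Lab p ⊕ Lab q
  | pop _ p q => Option (Lab p ⊕ (Σ a, Lab (q a)))
  | loop _ q => Option (Σ a, Lab (q a))

noncomputable instance labFintype [Fintype A] : (p : Prog K A) → Fintype (Lab p)
  | skip => inferInstanceAs (Fintype Unit)
  | push _ _ => inferInstanceAs (Fintype Unit)
  | seq p q =>
      letI := labFintype p
      letI := labFintype q
      inferInstanceAs (Fintype (Lab p ⊕ Lab q))
  | pop _ p q =>
      letI := labFintype p
      letI := fun a => labFintype (q a)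
      inferInstanceAs (Fintype (Option (Lab p ⊕ (Σ a, Lab (q a)))))
  | loop _ q =>
      letI := fun a => labFintype (q a)
      inferInstanceAs (Fintype (Option (Σ a, Lab (q a))))

/-- The control point at which a program starts. -/
def entry : (p : Prog K A) → Lab p
  | skip => ()
  | push _ _ => ()
  | seq p _ => Sum.inl (entry p)
  | pop _ _ _ => none
  | loop _ _ => none

/-- The TM2 code of a program whose control points are placed at `e` and that jumps to `x` in the
end. -/
def code {Λ : Type} : (p : Prog K A) → (Lab p → Λ) → Λ → Lab p →
    Turing.TM2.Stmt (fun _ : K => A) Λ (Option A)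
  | skip, _, x, _ => .goto fun _ => x
  | push k a, _, x, _ => .push k (fun _ => a) (.goto fun _ => x)
  | seq p _, e, _, Sum.inl l => code p (fun m => e (Sum.inl m)) (e (Sum.inr (entry _))) l
  | seq _ q, e, x, Sum.inr l => code q (fun m => e (Sum.inr m)) x l
  | pop k p q, e, _, none => .pop k (fun _ o => o) (.goto fun v =>
      match v with
      | none => e (some (Sum.inl (entry p)))
      | some a => e (some (Sum.inr ⟨a, entry (q a)⟩)))
  | pop _ p _, e, x, some (Sum.inl l) => code p (fun m => e (some (Sum.inl m))) x l
  | pop _ _ q, e, x, some (Sum.inr ⟨a, l⟩) =>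
      code (q a) (fun m => e (some (Sum.inr ⟨a, m⟩))) x l
  | loop k q, e, x, none => .pop k (fun _ o => o) (.goto fun v =>
      match v with
      | none => x
      | some a => e (some ⟨a, entry (q a)⟩))
  | loop _ q, e, _, some ⟨a, l⟩ => code (q a) (fun m => e (some ⟨a, m⟩)) (e none) l

/-! ### Simulation of structured programs by TM2 machines -/

variable [DecidableEq K]

/-- The internal state remembers the popped symbol, and the jump in the same machine step branches
on it. Popping from an empty stack leaves `none` there. -/
theorem step_pop {Λ : Type} (M : Λ → Turing.TM2.Stmt (fun _ : K => A) Λ (Option A)) {m : Λ}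
    {k : K} {f : Option A → Λ} (h : M m = .pop k (fun _ o => o) (.goto f)) (v : Option A)
    (s : K → List A) :
    flip bind (Turing.TM2.step M) (some ⟨some m, v, s⟩) =
      some ⟨some (f (s k).head?), (s k).head?, Function.update s k (s k).tail⟩ := by
  simp [flip, Turing.TM2.step, h]

/-- Induction on the run. The embedding `e` and the exit `x` are arbitrary, so that the hypothesis
applies to a subprogram placed inside a larger one; a loop body, for instance, exits to the head of
its loop. Programs never rely on the internal state left over from before, so its initial value is
arbitrary and its final value is only asserted to exist. -/
theorem Run.reaches {Λ : Type} (M : Λ → Turing.TM2.Stmt (fun _ : K => A) Λ (Option A))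
    {p : Prog K A} {s s' : K → List A} {t : ℕ} (h : p.Run s s' t) :
    ∀ (e : Lab p → Λ) (x : Λ), (∀ l, M (e l) = p.code e x l) → ∀ v, ∃ v',
      (flip bind (Turing.TM2.step M))^[t] (some ⟨some (e p.entry), v, s⟩) =
        some ⟨some x, v', s'⟩ := by
  induction h with
  | skip s =>
    intro e x hM v
    refine ⟨v, ?_⟩
    simp [flip, Turing.TM2.step, hM, code]
  | push s k a =>
    intro e x hM v
    refine ⟨v, ?_⟩
    simp [flip, Turing.TM2.step, hM, code]
  | @seq p q s s' s'' t t' _ _ ih₁ ih₂ =>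
    intro e x hM v
    obtain ⟨v₁, h₁⟩ := ih₁ (fun m => e (Sum.inl m)) (e (Sum.inr (entry q)))
      (fun l => hM (Sum.inl l)) v
    obtain ⟨v₂, h₂⟩ := ih₂ (fun m => e (Sum.inr m)) x (fun l => hM (Sum.inr l)) v₁
    refine ⟨v₂, ?_⟩
    rw [add_comm, Function.iterate_add_apply]
    exact (congrArg _ h₁).trans h₂
  | @pop_nil k p q s s' t hk _ ih =>
    intro e x hM v
    obtain ⟨v₁, h₁⟩ := ih (fun m => e (some (Sum.inl m))) x
      (fun l => hM (some (Sum.inl l))) none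
    have h₀ := step_pop M (hM (entry (pop k p q))) v s
    rw [hk, List.tail_nil, ← hk, Function.update_eq_self, hk] at h₀
    refine ⟨v₁, ?_⟩
    rw [Function.iterate_add_apply]
    exact (congrArg _ h₀).trans h₁
  | @pop_cons k p q s s' t a l hk _ ih =>
    intro e x hM v
    obtain ⟨v₁, h₁⟩ := ih (fun m => e (some (Sum.inr ⟨a, m⟩))) x
      (fun l => hM (some (Sum.inr ⟨a, l⟩))) (some a)
    have h₀ := step_pop M (hM (entry (pop k p q))) v s
    rw [hk] at h₀
    refine ⟨v₁, ?_⟩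
    rw [Function.iterate_add_apply]
    exact (congrArg _ h₀).trans h₁
  | @loop_nil k q s hk =>
    intro e x hM v
    have h₀ := step_pop M (hM (entry (loop k q))) v s
    rw [hk, List.tail_nil, ← hk, Function.update_eq_self, hk] at h₀
    exact ⟨none, h₀⟩
  | @loop_cons k q s s' s'' t t' a l hk _ _ ih₁ ih₂ =>
    intro e x hM v
    obtain ⟨v₁, h₁⟩ := ih₁ (fun m => e (some ⟨a, m⟩)) (e none)
      (fun l => hM (some ⟨a, l⟩)) (some a)
    obtain ⟨v₂, h₂⟩ := ih₂ e x hM v₁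
    have h₀ := step_pop M (hM (entry (loop k q))) v s
    rw [hk] at h₀
    refine ⟨v₂, ?_⟩
    rw [show t + t' + 1 = t' + (t + 1) by omega, Function.iterate_add_apply,
      Function.iterate_add_apply (m := t)]
    exact (congrArg _ ((congrArg _ h₀).trans h₁)).trans h₂

/-- The machine that executes a program. -/
noncomputable def machine [Fintype K] (p : Prog K (Option Bool)) (i o : K) :
    Turing.TM2ComputableAux (Option Bool) (Option Bool) where
  tm :=
    { K := K
      k₀ := i
      k₁ := o
      Γ := fun _ => Option Bool
      Λ := Option (Lab p)
      main := some p.entry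
      ΛFin := inferInstance
      σ := Option (Option Bool)
      initialState := none
      m := fun l => match l with
        | none => .load (fun _ => none) .halt
        | some l => p.code some none l }
  inputAlphabet := Equiv.refl _
  outputAlphabet := Equiv.refl _

/-- The additional step is spent at the label `none`: a halting configuration has to carry the
initial internal state, so the machine resets it before it halts. -/
theorem Run.outputsInTime [Fintype K] {p : Prog K (Option Bool)} {i o : K}
    {u v : List (Option Bool)} {t T : ℕ}
    (h : p.Run (Function.update (fun _ => []) i u) (Function.update (fun _ => []) o v) t)
    (hT : t + 1 ≤ T) :
    Nonempty (Turing.TM2OutputsInTime (machine p i o).tm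
      (u.map (machine p i o).inputAlphabet.symm)
      (some (v.map (machine p i o).outputAlphabet.symm)) T) := by
  obtain ⟨v', hv⟩ := h.reaches (machine p i o).tm.m some none (fun l => rfl) none
  have hu : u.map (machine p i o).inputAlphabet.symm = u := List.map_id u
  have hw : v.map (machine p i o).outputAlphabet.symm = v := List.map_id v
  have hup : ∀ (k : K) (l : List (Option Bool)), (Function.update (fun _ => []) k l : K → _) =
      fun j => if j = k then l else [] := by
    intro k l
    funext j
    simp [Function.update_apply]
  refine ⟨⟨⟨t + 1, ?_⟩, hT⟩⟩
  rw [add_comm, Function.iterate_add_apply]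
  have hi : Turing.initList (machine p i o).tm
      (u.map (machine p i o).inputAlphabet.symm) =
      ⟨some (some p.entry), none, Function.update (fun _ => []) i u⟩ :=
    (congrArg (Turing.initList (machine p i o).tm) hu).trans
      (congrArg (Turing.TM2.Cfg.mk (some (some p.entry)) none) (hup i u).symm)
  have ho : Turing.haltList (machine p i o).tm
      (v.map (machine p i o).outputAlphabet.symm) =
      ⟨none, none, Function.update (fun _ => []) o v⟩ :=
    (congrArg (Turing.haltList (machine p i o).tm) hw).trans
      (congrArg (Turing.TM2.Cfg.mk none none) (hup o v).symm)
  refine (congrArg _ ((congrArg (fun c => (flip bind _)^[t] (some c)) hi).trans hv)).trans ?_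
  exact congrArg some ho.symm

/-- The program stops within `T` steps. -/
def RunLE (p : Prog K A) (s s' : K → List A) (T : ℕ) : Prop := ∃ t ≤ T, p.Run s s' t

end Prog

end GrundyW

/-! ### Running times of the basic stack operations -/

namespace GrundyW

namespace Prog

variable {K A : Type} [DecidableEq K]

theorem RunLE.mono {p : Prog K A} {s s' : K → List A} {T T' : ℕ} (h : p.RunLE s s' T)
    (hT : T ≤ T') : p.RunLE s s' T' :=
  let ⟨t, ht, hr⟩ := h
  ⟨t, ht.trans hT, hr⟩

theorem RunLE.seq {p q : Prog K A} {s s' s'' : K → List A} {T T' : ℕ} (h : p.RunLE s s' T)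
    (h' : q.RunLE s' s'' T') : (p.seq q).RunLE s s'' (T + T') :=
  let ⟨t, ht, hr⟩ := h
  let ⟨t', ht', hr'⟩ := h'
  ⟨t + t', add_le_add ht ht', .seq hr hr'⟩

theorem runLE_skip (s : K → List A) : (skip : Prog K A).RunLE s s 1 := ⟨1, le_rfl, .skip s⟩

theorem runLE_push (s : K → List A) (k : K) (a : A) :
    (push k a).RunLE s (Function.update s k (a :: s k)) 1 := ⟨1, le_rfl, .push s k a⟩

theorem runLE_pop_nil {k : K} {p : Prog K A} {q : A → Prog K A} {s s' : K → List A} {T : ℕ}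
    (hk : s k = []) (h : p.RunLE s s' T) : (pop k p q).RunLE s s' (T + 1) :=
  let ⟨t, ht, hr⟩ := h
  ⟨t + 1, by omega, .pop_nil hk hr⟩

theorem runLE_pop_cons {k : K} {p : Prog K A} {q : A → Prog K A} {s s' : K → List A} {T : ℕ}
    {a : A} {l : List A} (hk : s k = a :: l) (h : (q a).RunLE (Function.update s k l) s' T) :
    (pop k p q).RunLE s s' (T + 1) :=
  let ⟨t, ht, hr⟩ := h
  ⟨t + 1, by omega, .pop_cons hk hr⟩

/-- `S i` are the stacks after `i` rounds of the loop. -/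
theorem runLE_loop {k : K} {q : A → Prog K A} {T : ℕ} (l : List A) :
    ∀ S : ℕ → K → List A, (∀ i ≤ l.length, S i k = l.drop i) →
      (∀ (i : ℕ) (hi : i < l.length),
        (q l[i]).RunLE (Function.update (S i) k (l.drop (i + 1))) (S (i + 1)) T) →
      (loop k q).RunLE (S 0) (S l.length) ((T + 1) * l.length + 1) := by
  induction l with
  | nil =>
    intro S hS _
    exact ⟨1, by simp, .loop_nil (hS 0 le_rfl)⟩
  | cons a l ih =>
    intro S hS hq
    obtain ⟨t, ht, hr⟩ := hq 0 (by simp)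
    obtain ⟨t', ht', hr'⟩ := ih (fun i => S (i + 1))
      (fun i hi => by simpa using hS (i + 1) (by simpa using hi))
      (fun i hi => hq (i + 1) (by simpa using hi))
    refine ⟨t + t' + 1, ?_, .loop_cons (hS 0 (by simp)) hr hr'⟩
    simp only [List.length_cons]
    linarith

/-- Pushes the symbols of a list one after the other. -/
def pushAll (k : K) (l : List A) : Prog K A := l.foldr (fun a p => seq (push k a) p) skip

theorem runLE_pushAll (k : K) (l : List A) : ∀ s : K → List A,
    (pushAll k l).RunLE s (Function.update s k (l.reverse ++ s k)) (l.length + 1) := by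
  induction l with
  | nil =>
    intro s
    simpa [pushAll] using runLE_skip s
  | cons a l ih =>
    intro s
    have h := (runLE_push s k a).seq (ih (Function.update s k (a :: s k)))
    simp only [Function.update_idem, Function.update_self] at h
    simp only [List.reverse_cons, List.append_assoc, List.singleton_append, List.length_cons]
    exact h.mono (by omega)

/-- Empties the stack `k`. -/
def drain (k : K) : Prog K A := loop k fun _ => skip

theorem runLE_drain (k : K) (s : K → List A) :
    (drain k).RunLE s (Function.update s k []) (2 * (s k).length + 1) := by
  have h := runLE_loop (k := k) (q := fun _ => (skip : Prog K A)) (T := 1) (s k)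
    (fun i => Function.update s k ((s k).drop i)) (fun i _ => by simp)
    (fun i _ => by simpa using runLE_skip _)
  simpa [drain] using h

/-- Moves the stack `k` to the stack `d`, which reverses it. -/
def move (k d : K) : Prog K A := loop k fun a => push d a

theorem runLE_move {k d : K} (hkd : k ≠ d) (s : K → List A) :
    (move k d).RunLE s (Function.update (Function.update s k []) d ((s k).reverse ++ s d))
      (2 * (s k).length + 1) := by
  have h := runLE_loop (k := k) (q := fun a => push d a) (T := 1) (s k)
    (fun i => Function.update (Function.update s k ((s k).drop i)) d
      (((s k).take i).reverse ++ s d)) (fun i _ => by simp [hkd])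
    (fun i hi => by
      convert runLE_push _ d _ using 1
      funext j
      by_cases hd : j = d
      · subst hd
        simp [hkd.symm, ← List.take_append_getElem hi, -List.take_append_getElem]
      · by_cases hk : j = k
        · subst hk
          simp [hkd]
        · simp [hd, hk])
  simpa [move] using h

/-- Reads the stack `k` with the help of the stack `m`, and pushes `f a` on the stack `d` for each
symbol `a`. The stack `k` is restored. -/
def scan (k m d : K) (f : A → List A) : Prog K A :=
  seq (loop k fun a => seq (push m a) (pushAll d (f a))) (move m k)

/-- Popping `k` onto `m` reverses it and moving it back reverses it again, which restores `k`. Each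
symbol costs at most `c + 3` steps in the loop and 2 steps on the way back. -/
theorem runLE_scan {k m d : K} (hkm : k ≠ m) (hkd : k ≠ d) (hmd : m ≠ d) {f : A → List A} {c : ℕ}
    (hf : ∀ a, (f a).length ≤ c) (s : K → List A) (hm : s m = []) :
    (scan k m d f).RunLE s (Function.update s d (((s k).flatMap f).reverse ++ s d))
      ((c + 5) * (s k).length + 2) := by
  have h := runLE_loop (k := k) (q := fun a => seq (push m a) (pushAll d (f a))) (T := c + 2) (s k)
    (fun i => Function.update (Function.update (Function.update s k ((s k).drop i)) m
      ((s k).take i).reverse) d ((((s k).take i).flatMap f).reverse ++ s d))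
    (fun i _ => by simp [hkd, hkm])
    (fun i hi => by
      have h := ((runLE_push (Function.update (Function.update (Function.update
        (Function.update s k ((s k).drop i)) m ((s k).take i).reverse) d
          ((((s k).take i).flatMap f).reverse ++ s d)) k ((s k).drop (i + 1)))
          m (s k)[i]).seq (runLE_pushAll d (f (s k)[i]) _)).mono
          (T' := c + 2) (by have := hf (s k)[i]; omega)
      convert h using 1
      funext j
      by_cases hd : j = d
      · subst hd
        simp [hkd.symm, hmd.symm, ← List.take_append_getElem hi,
            -List.take_append_getElem]
      · by_cases hk : j = k
        · subst hk
          simp [hkd, hkm]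
        · by_cases hj : j = m
          · subst hj
            simp [hkm.symm, hmd, ← List.take_append_getElem hi,
            -List.take_append_getElem]
          · simp [hd, hk, hj])
  have h' := h.seq (runLE_move hkm.symm _)
  refine RunLE.mono (T := (c + 2 + 1) * (s k).length + 1 + (2 * (s k).length + 1)) ?_ (by linarith)
  convert h' using 1
  · rfl
  · have h₀ := Function.update_eq_self m s
    rw [hm] at h₀
    simp [h₀]
  · funext j
    by_cases hd : j = d
    · subst hd
      simp [hkd.symm, hmd.symm]
    · by_cases hk : j = k
      · subst hk
        simp [hkd, hkm, hmd]
      · by_cases hj : j = m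
        · subst hj
          simp [hkm.symm, hmd, hm]
        · simp [hd, hk, hj]
  · simp [hmd]

end Prog

end GrundyW

namespace GrundyW

/-! ### A language for polynomial-time word functions -/

/-- Names of the natural numbers that a word function depends on. -/
abbrev Var : Type := Fin 20

/-- The stacks of the machine that evaluates a word function. -/
inductive Stk : Type
  | inp | out | data | res | tmp | cmpA | cmpB | flag
  | val (x : Var)
  | cnt (x : Var)
  deriving DecidableEq, Fintype

/-- Expressions for words that depend on numbers and on a data word. -/
inductive Gen : Type
  /-- a fixed word -/
  | lit (l : List Bool)
  /-- a number in unary -/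
  | ones (x : Var)
  /-- the data word, every bit `b` of which is written as `true`, `b`, `false` -/
  | bits
  | app (e f : Gen)
  /-- concatenation over all `x < r` -/
  | loop (x r : Var) (e : Gen)
  /-- binds `x` to the length of `e` in `f` -/
  | letLen (x : Var) (e f : Gen)
  /-- `e` if `x = y`, and the empty word otherwise -/
  | ifEq (x y : Var) (e : Gen)

namespace Gen

def eval : Gen → (Var → ℕ) → List Bool → List Bool
  | lit l, _, _ => l
  | ones x, v, _ => List.replicate (v x) true
  | bits, _, w => w.flatMap fun b => [true, b, false]
  | app e f, v, w => e.eval v w ++ f.eval v w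
  | loop x r e, v, w => (List.range (v r)).flatMap fun i => e.eval (Function.update v x i) w
  | letLen x e f, v, w => f.eval (Function.update v x (e.eval v w).length) w
  | ifEq x y e, v, w => if v x = v y then e.eval v w else []

/-- Only numbers from `R` are read, and only numbers outside `B` are bound. -/
def ok : Gen → List Var → List Var → Bool
  | lit _, _, _ => true
  | ones x, R, _ => decide (x ∈ R)
  | bits, _, _ => true
  | app e f, R, B => e.ok R B && f.ok R B
  | loop x r e, R, B => decide (r ∈ R) && decide (x ∉ B) && e.ok (x :: R) (x :: B)
  | letLen x e f, R, B => decide (x ∉ B) && e.ok R (x :: B) && f.ok (x :: R) (x :: B)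
  | ifEq x y e, R, B => decide (x ∈ R) && decide (y ∈ R) && e.ok R B

/-- A bound on the running time if all numbers and the data word have size at most `M`. -/
def time : Gen → ℕ → ℕ
  | lit l, _ => l.length + 1
  | ones _, M => 6 * M + 2
  | bits, M => 8 * M + 2
  | app e f, M => e.time M + f.time M
  | loop _ _ e, M => (6 * M + 2) + (((e.time M + 1) + 1) * M + 1) + (2 * M + 1)
  | letLen _ e f, M => e.time M + (f.time (M + e.time M) + (2 * e.time M + 1))
  | ifEq _ _ e, M => (6 * M + 2) + ((6 * M + 2) + ((3 * M + 1) + ((2 * M + 1) +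
      (e.time M + (4 * M + 2)))))

/-- The expression is fixed, so a nested loop only contributes a factor `M`. Binding a length may
enlarge the numbers from `M` to `M + e.time M`, which composes polynomials. -/
theorem exists_polynomial (e : Gen) : ∃ p : Polynomial ℕ, ∀ M, e.time M = p.eval M := by
  induction e with
  | lit l => exact ⟨Polynomial.C (l.length + 1), fun M => by simp [time]⟩
  | ones x => exact ⟨6 * Polynomial.X + 2, fun M => by simp [time]⟩
  | bits => exact ⟨8 * Polynomial.X + 2, fun M => by simp [time]⟩
  | app e f he hf =>
    obtain ⟨p, hp⟩ := he
    obtain ⟨q, hq⟩ := hf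
    exact ⟨p + q, fun M => by simp [time, hp, hq]⟩
  | loop x r e he =>
    obtain ⟨p, hp⟩ := he
    exact ⟨(6 * Polynomial.X + 2) + (((p + 1) + 1) * Polynomial.X + 1) + (2 * Polynomial.X + 1),
      fun M => by simp [time, hp]⟩
  | letLen x e f he hf =>
    obtain ⟨p, hp⟩ := he
    obtain ⟨q, hq⟩ := hf
    exact ⟨p + (q.comp (Polynomial.X + p) + (2 * p + 1)), fun M => by simp [time, hp, hq]⟩
  | ifEq x y e he =>
    obtain ⟨p, hp⟩ := he
    exact ⟨(6 * Polynomial.X + 2) + ((6 * Polynomial.X + 2) + ((3 * Polynomial.X + 1) +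
      ((2 * Polynomial.X + 1) + (p + (4 * Polynomial.X + 2))))), fun M => by simp [time, hp]⟩

/-- This bounds the numbers that `letLen` creates, and hence the time spent on expressions that read
them. -/
theorem length_eval_le (e : Gen) : ∀ (R B : List Var) (v : Var → ℕ) (w : List Bool) (M : ℕ),
    e.ok R B → (∀ x ∈ R, v x ≤ M) → w.length ≤ M → (e.eval v w).length ≤ e.time M := by
  induction e with
  | lit l => intros; simp [eval, time]
  | ones x =>
    intro R B v w M hok hv hw
    have := hv x (by simpa [ok] using hok)
    simp only [eval, time, List.length_replicate]
    omega
  | bits =>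
    intro R B v w M hok hv hw
    have : (eval bits v w).length = w.length * 3 := by
      simp only [eval]
      induction w with
      | nil => rfl
      | cons b w ih => simp [List.flatMap_cons, ih (by simp at hw; omega)]; omega
    rw [this]
    simp only [time]
    omega
  | app e f he hf =>
    intro R B v w M hok hv hw
    simp only [ok, Bool.and_eq_true] at hok
    have h₁ := he R B v w M hok.1 hv hw
    have h₂ := hf R B v w M hok.2 hv hw
    simp only [eval, time, List.length_append]
    omega
  | loop x r e he =>
    intro R B v w M hok hv hw
    simp only [ok, Bool.and_eq_true, decide_eq_true_eq] at hok
    have hr := hv r hok.1.1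
    have : (eval (loop x r e) v w).length ≤ v r * e.time M := by
      simp only [eval, List.length_flatMap]
      refine (List.sum_le_card_nsmul _ (e.time M) ?_).trans (by simp)
      intro y hy
      simp only [List.mem_map, List.mem_range] at hy
      obtain ⟨i, hi, rfl⟩ := hy
      refine he _ _ _ _ _ hok.2 (fun z hz => ?_) hw
      rcases eq_or_ne z x with rfl | hzx
      · simp; omega
      · simpa [hzx] using hv z (by simpa [hzx] using hz)
    refine this.trans ?_
    simp only [time]
    nlinarith [Nat.mul_le_mul_right (e.time M) hr]
  | letLen x e f he hf =>
    intro R B v w M hok hv hw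
    simp only [ok, Bool.and_eq_true, decide_eq_true_eq] at hok
    have h₁ := he _ _ v w M hok.1.2 hv hw
    simp only [eval, time]
    refine (hf _ _ _ w (M + e.time M) hok.2 (fun z hz => ?_) (by omega)).trans (by omega)
    rcases eq_or_ne z x with rfl | hzx
    · simp; omega
    · have := hv z (by simpa [hzx] using hz)
      simp [hzx]; omega
  | ifEq x y e he =>
    intro R B v w M hok hv hw
    simp only [ok, Bool.and_eq_true, decide_eq_true_eq] at hok
    have h₁ := he R B v w M hok.2 hv hw
    simp only [eval, time]
    split_ifs
    · omega
    · simp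

/-- The program that pushes the value of an expression on the stack `t`. -/
def compile : Gen → Stk → Prog Stk (Option Bool)
  | lit l, t => .pushAll t (l.map some)
  | ones x, t => .scan (.val x) .tmp t fun _ => [some true]
  | bits, t => .scan .data .tmp t fun a => [some true, a, some false]
  | app e f, t => .seq (e.compile t) (f.compile t)
  | loop x r e, t => .seq (.seq (.scan (.val r) .tmp (.cnt x) fun a => [a])
      (.loop (.cnt x) fun _ => .seq (e.compile t) (.push (.val x) (some true))))
      (.drain (.val x))
  | letLen x e f, t => .seq (e.compile (.val x)) (.seq (f.compile t) (.drain (.val x)))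
  | ifEq x y e, t => .seq (.scan (.val x) .tmp .cmpA fun a => [a]) (.seq
      (.scan (.val y) .tmp .cmpB fun a => [a]) (.seq
      (.loop .cmpA fun _ => .pop .cmpB (.push .flag (some true)) fun _ => .skip) (.seq
      (.loop .cmpB fun _ => .push .flag (some true))
      (.pop .flag (e.compile t) fun _ => .drain .flag))))

/-- The stacks `s` hold the numbers `v x` for `x ∈ R` and the data word `w`, and have room for
numbers outside `B`. -/
structure Rep (R B : List Var) (v : Var → ℕ) (w : List Bool) (s : Stk → List (Option Bool)) :
    Prop where
  sub : ∀ x ∈ R, x ∈ B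
  len : ∀ x ∈ R, (s (.val x)).length = v x
  val_nil : ∀ x ∉ B, s (.val x) = []
  cnt_nil : ∀ x ∉ B, s (.cnt x) = []
  data : s .data = w.map some
  tmp : s .tmp = []
  cmpA : s .cmpA = []
  cmpB : s .cmpB = []
  flag : s .flag = []

/-- The stack `t` may receive the value of an expression. -/
def Target (R B : List Var) (t : Stk) : Prop := t = .res ∨ ∃ a ∈ B, a ∉ R ∧ t = .val a

theorem Target.cons {R B : List Var} {t : Stk} (h : Target R B t) {x : Var} (hx : x ∉ B) :
    Target (x :: R) (x :: B) t := by
  obtain rfl | ⟨a, ha, ha', rfl⟩ := h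
  · exact Or.inl rfl
  · refine Or.inr ⟨a, by simp [ha], ?_, rfl⟩
    simp only [List.mem_cons, not_or]
    exact ⟨fun h => hx (h ▸ ha), ha'⟩

/-- A target is none of the stacks that an evaluation reads or expects to be empty. A register that
is being filled lies in `B` but not yet in `R`. -/
theorem Target.ne {R B : List Var} {t : Stk} (h : Target R B t) : (∀ x ∈ R, t ≠ .val x) ∧
    (∀ x ∉ B, t ≠ .val x) ∧ (∀ x, t ≠ .cnt x) ∧ t ≠ .data ∧ t ≠ .tmp ∧ t ≠ .cmpA ∧ t ≠ .cmpB ∧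
    t ≠ .flag := by
  obtain rfl | ⟨a, ha, ha', rfl⟩ := h
  · simp
  · simp only [ne_eq, Stk.val.injEq, reduceCtorEq, not_false_eq_true, implies_true, and_true]
    exact ⟨fun x hx h => ha' (h ▸ hx), fun x hx h => hx (h ▸ ha)⟩

theorem Rep.update {R B : List Var} {v : Var → ℕ} {w : List Bool} {s : Stk → List (Option Bool)}
    (h : Rep R B v w s) {t : Stk} (ht : Target R B t) (l : List (Option Bool)) :
    Rep R B v w (Function.update s t l) := by
  obtain ⟨h₁, h₂, h₃, h₄, h₅, h₆, h₇, h₈⟩ := ht.ne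
  exact ⟨h.sub, fun x hx => by rw [Function.update_of_ne (h₁ x hx).symm, h.len x hx],
    fun x hx => by rw [Function.update_of_ne (h₂ x hx).symm, h.val_nil x hx],
    fun x hx => by rw [Function.update_of_ne (h₃ x).symm, h.cnt_nil x hx],
    by rw [Function.update_of_ne h₄.symm, h.data],
    by rw [Function.update_of_ne h₅.symm, h.tmp],
    by rw [Function.update_of_ne h₆.symm, h.cmpA],
    by rw [Function.update_of_ne h₇.symm, h.cmpB],
    by rw [Function.update_of_ne h₈.symm, h.flag]⟩

/-- Binding the number `x`. The counter of `x` becomes arbitrary. -/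
theorem Rep.bind {R B : List Var} {v : Var → ℕ} {w : List Bool} {s : Stk → List (Option Bool)}
    (h : Rep R B v w s) {x : Var} (hx : x ∉ B) (l c : List (Option Bool)) :
    Rep (x :: R) (x :: B) (Function.update v x l.length) w
      (Function.update (Function.update s (.cnt x) c) (.val x) l) := by
  have hR : ∀ z ∈ R, z ≠ x := fun z hz hzx => hx (hzx ▸ h.sub z hz)
  refine ⟨?_, ?_, ?_, ?_, ?_, ?_, ?_, ?_, ?_⟩
  · intro z hz
    rcases List.mem_cons.1 hz with rfl | hz
    · simp
    · simp [h.sub z hz]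
  · intro z hz
    rcases List.mem_cons.1 hz with rfl | hz
    · simp
    · simp [hR z hz, h.len z hz]
  · intro z hz
    simp only [List.mem_cons, not_or] at hz
    simp [hz.1, h.val_nil z hz.2]
  · intro z hz
    simp only [List.mem_cons, not_or] at hz
    simp [hz.1, h.cnt_nil z hz.2]
  · simp [h.data]
  · simp [h.tmp]
  · simp [h.cmpA]
  · simp [h.cmpB]
  · simp [h.flag]

end Gen

end GrundyW

/-! ### Correctness and running time of compiled expressions -/

namespace GrundyW

open Prog

namespace Gen

/-- The stacks after the word `l` has been pushed on the stack `t`. -/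
def emit (s : Stk → List (Option Bool)) (t : Stk) (l : List Bool) : Stk → List (Option Bool) :=
  Function.update s t ((l.map some).reverse ++ s t)

theorem emit_append (s : Stk → List (Option Bool)) (t : Stk) (l l' : List Bool) :
    emit (emit s t l) t l' = emit s t (l ++ l') := by
  simp [emit]

/-- The stacks after the symbols of the stack `k` have been added to the stack `t`. -/
theorem runLE_copy {k t : Stk} (h₁ : k ≠ .tmp) (h₂ : k ≠ t) (h₃ : .tmp ≠ t)
    {s : Stk → List (Option Bool)} (hs : s .tmp = []) {n : ℕ} (hn : (s k).length ≤ n) :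
    (scan k .tmp t fun a => [a]).RunLE s (Function.update s t ((s k).reverse ++ s t))
      (6 * n + 2) := by
  have h := runLE_scan h₁ h₂ h₃ (f := fun a => [a]) (c := 1) (by simp) s hs
  simp only [List.flatMap_singleton'] at h
  exact h.mono (by omega)

/-- Compares the heights `a` and `b` of two stacks: afterwards the flag stack is empty if and only
if `a = b`. -/
theorem runLE_compare {s : Stk → List (Option Bool)} (hs : s .flag = []) (hA : s .cmpA = [])
    (hB : s .cmpB = []) (A B : List (Option Bool)) {n : ℕ} (hAn : A.length ≤ n)
    (hBn : B.length ≤ n) :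
    (seq (Prog.loop Stk.cmpA fun _ => pop .cmpB (push .flag (some true)) fun _ => skip)
      (Prog.loop Stk.cmpB fun _ => push .flag (some true))).RunLE
      (Function.update (Function.update s .cmpA A) .cmpB B)
      (Function.update s .flag
        (List.replicate ((A.length - B.length) + (B.length - A.length)) (some true)))
      ((3 * n + 1) + (2 * n + 1)) := by
  have h₁ := runLE_loop (k := Stk.cmpA)
    (q := fun _ => pop .cmpB (push .flag (some true)) fun _ => skip) (T := 2) A
    (fun i => Function.update (Function.update (Function.update s .cmpA (A.drop i))
      .cmpB (B.drop i)) .flag (List.replicate (i - B.length) (some true)))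
    (fun i _ => by simp)
    (fun i hi => by
      rcases Nat.lt_or_ge i B.length with hB | hB
      · refine runLE_pop_cons (a := B[i]) (l := B.drop (i + 1)) (by simp) ?_
        convert runLE_skip (K := Stk) (A := Option Bool) _ using 1
        funext j
        rw [Nat.sub_eq_zero_of_le hB.le, Nat.sub_eq_zero_of_le hB]
        cases j <;> simp
      · refine runLE_pop_nil (by simpa using hB) ?_
        convert runLE_push (K := Stk) (A := Option Bool) _ _ _ using 1
        funext j
        rw [List.drop_eq_nil_of_le hB, List.drop_eq_nil_of_le (by omega : B.length ≤ i + 1),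
          Nat.sub_add_comm hB]
        cases j <;> simp [List.replicate_succ])
  have h₂ := runLE_loop (k := Stk.cmpB) (q := fun _ => push Stk.flag (some true)) (T := 1)
    (B.drop A.length)
    (fun i => Function.update (Function.update s .cmpB ((B.drop A.length).drop i))
      .flag (List.replicate ((A.length - B.length) + i) (some true)))
    (fun i _ => by simp)
    (fun i hi => by
      convert runLE_push (K := Stk) (A := Option Bool) _ _ _ using 1
      funext j
      cases j <;> simp [List.replicate_succ, ← add_assoc])
  have h₀ : Function.update (Function.update (Function.update s .cmpA (A.drop 0))
      .cmpB (B.drop 0)) .flag (List.replicate (0 - B.length) (some true)) =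
      Function.update (Function.update s .cmpA A) .cmpB B := by
    funext j
    cases j <;> simp [hs]
  have h₃ : Function.update (Function.update (Function.update s .cmpA (A.drop A.length))
      .cmpB (B.drop A.length)) .flag (List.replicate (A.length - B.length) (some true)) =
      Function.update (Function.update s .cmpB ((B.drop A.length).drop 0))
      .flag (List.replicate ((A.length - B.length) + 0) (some true)) := by
    funext j
    cases j <;> simp [hA]
  have h₄ : Function.update (Function.update s .cmpB ((B.drop A.length).drop
      (B.drop A.length).length))
      .flag (List.replicate ((A.length - B.length) + (B.drop A.length).length) (some true)) =
      Function.update s .flag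
        (List.replicate ((A.length - B.length) + (B.length - A.length)) (some true)) := by
    funext j
    cases j <;> simp [hB]
    omega
  rw [h₀, h₃] at h₁
  rw [h₄] at h₂
  refine (h₁.seq h₂).mono ?_
  simp only [List.length_drop]
  omega

/-- Induction on the expression. Evaluation changes the target stack alone: auxiliary stacks are
empty again at the end, so the invariant `Rep` survives and the next expression can start from it.
-/
theorem runLE_compile (e : Gen) : ∀ (R B : List Var) (t : Stk) (v : Var → ℕ) (w : List Bool)
    (M : ℕ) (s : Stk → List (Option Bool)), e.ok R B → Target R B t → Rep R B v w s →
    (∀ x ∈ R, v x ≤ M) → w.length ≤ M → (e.compile t).RunLE s (emit s t (e.eval v w)) (e.time M) := by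
  induction e with
  | lit l =>
    intro R B t v w M s hok ht hs hv hw
    simpa [compile, eval, emit, time] using runLE_pushAll t (l.map some) s
  | ones x =>
    intro R B t v w M s hok ht hs hv hw
    have hx : x ∈ R := by simpa [ok] using hok
    have hl := hs.len x hx
    have h := runLE_scan (k := Stk.val x) (m := .tmp) (d := t) (by simp) (ht.ne.1 x hx).symm
      ht.ne.2.2.2.2.1.symm (f := fun _ => [some true]) (c := 1) (by simp) s hs.tmp
    have hf : (s (.val x)).flatMap (fun _ => [some true]) = List.replicate (v x) (some true) := by
      rw [← hl]
      induction s (.val x) with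
      | nil => rfl
      | cons a l ih => rw [List.flatMap_cons, ih]; rfl
    rw [hf, hl] at h
    have := hv x hx
    simp only [compile, eval, emit, time, List.map_replicate]
    exact h.mono (by omega)
  | bits =>
    intro R B t v w M s hok ht hs hv hw
    have h := runLE_scan (k := Stk.data) (m := .tmp) (d := t) (by simp) ht.ne.2.2.2.1.symm
      ht.ne.2.2.2.2.1.symm (f := fun a => [some true, a, some false]) (c := 3) (by simp) s hs.tmp
    have hf : (s .data).flatMap (fun a => [some true, a, some false]) =
        ((eval bits v w).map some) := by
      rw [hs.data]
      simp [eval, List.flatMap_map, List.map_flatMap]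
    rw [hf, hs.data, List.length_map] at h
    simp only [compile, emit, time]
    exact h.mono (by omega)
  | app e f he hf =>
    intro R B t v w M s hok ht hs hv hw
    simp only [ok, Bool.and_eq_true] at hok
    have h₁ := he R B t v w M s hok.1 ht hs hv hw
    have h₂ := hf R B t v w M (emit s t (e.eval v w)) hok.2 ht (hs.update ht _) hv hw
    have h := h₁.seq h₂
    rw [emit_append] at h
    exact h
  | loop x r e he =>
    intro R B t v w M s hok ht hs hv hw
    simp only [ok, Bool.and_eq_true, decide_eq_true_eq] at hok
    obtain ⟨⟨hr, hx⟩, hok⟩ := hok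
    have hl := hs.len r hr
    have hrM := hv r hr
    have h₁ := runLE_copy (k := .val r) (t := .cnt x) (by simp) (by simp) (by simp) hs.tmp
      (hl.trans_le hrM)
    have htx := ht.ne.2.1 x hx
    have htc := ht.ne.2.2.1 x
    set c := (s (.val r)).reverse with hc
    have hcl : c.length = v r := by rw [hc, List.length_reverse, hl]
    rw [hs.cnt_nil x hx, List.append_nil] at h₁
    -- Each round takes one symbol from the counter and adds one to the register of `x`, so in round
    -- `i` the register holds exactly `i`.
    let S : ℕ → Stk → List (Option Bool) := fun i =>
      emit (Function.update (Function.update s (.cnt x) (c.drop i)) (.val x)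
        (List.replicate i (some true))) t
        ((List.range i).flatMap fun i => e.eval (Function.update v x i) w)
    have h₂ := runLE_loop (k := Stk.cnt x)
      (q := fun _ => .seq (e.compile t) (.push (.val x) (some true))) (T := e.time M + 1) c S
      (fun i _ => by simp [S, emit, htc.symm])
      (fun i hi => by
        have hrep := (hs.bind hx (List.replicate i (some true)) (c.drop (i + 1)))
        rw [List.length_replicate] at hrep
        have h := he (x :: R) (x :: B) t _ w M _ hok (ht.cons hx)
          (hrep.update (ht.cons hx) ((((List.range i).flatMap fun i =>
            e.eval (Function.update v x i) w).map some).reverse ++ s t))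
          (fun z hz => by
            rcases eq_or_ne z x with rfl | hzx
            · simp; omega
            · simpa [hzx] using hv z (by simpa [hzx] using hz)) hw
        convert h.seq (runLE_push _ (.val x) (some true)) using 1
        · funext j
          by_cases hj : j = t
          · subst hj
            simp [S, emit, htc, htx]
          · by_cases hj' : j = .cnt x
            · subst hj'
              simp [S, emit, hj]
            · by_cases hj'' : j = .val x
              · subst hj''
                simp [S, emit, hj]
              · simp [S, emit, hj, hj', hj'']
        · funext j
          by_cases hj : j = t
          · subst hj
            simp [S, emit, htc, htx, List.range_succ]
          · by_cases hj' : j = .val x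
            · subst hj'
              simp [S, emit, hj, List.replicate_succ]
            · by_cases hj'' : j = .cnt x
              · subst hj''
                simp [S, emit, hj]
              · simp [S, emit, hj, hj', hj''])
    have hS0 : S 0 = Function.update s (.cnt x) c := by
      funext j
      by_cases hj : j = t
      · subst hj
        simp [S, emit, htc, htx]
      · by_cases hj' : j = .val x
        · subst hj'
          simp [S, emit, hj, hs.val_nil x hx]
        · simp [S, emit, hj, hj']
    rw [hS0] at h₂
    have h₃ := runLE_drain (Stk.val x) (S c.length)
    have hS : Function.update (S c.length) (.val x) [] = emit s t (eval (loop x r e) v w) := by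
      funext j
      by_cases hj : j = t
      · subst hj
        simp [S, emit, htc, htx, eval, hcl]
      · by_cases hj' : j = .val x
        · subst hj'
          simp [emit, hj, hs.val_nil x hx]
        · by_cases hj'' : j = .cnt x
          · subst hj''
            simp [S, emit, hj, hs.cnt_nil x hx]
          · simp [S, emit, hj, hj', hj'']
    have hSl : (S c.length (.val x)).length = v r := by
      simp [S, emit, htx.symm, hcl]
    rw [hS, hSl] at h₃
    refine ((h₁.seq h₂).seq h₃).mono ?_
    rw [hcl]
    simp only [time]
    have := Nat.mul_le_mul_left (e.time M + 1 + 1) hrM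
    omega
  | letLen x e f he hf =>
    intro R B t v w M s hok ht hs hv hw
    simp only [ok, Bool.and_eq_true, decide_eq_true_eq] at hok
    obtain ⟨⟨hx, hoke⟩, hokf⟩ := hok
    have hR : ∀ z ∈ R, z ≠ x := fun z hz hzx => hx (hzx ▸ hs.sub z hz)
    have htx := ht.ne.2.1 x hx
    have hle := length_eval_le e _ _ v w M hoke hv hw
    -- While `e` is evaluated, its output goes directly to the register of `x`: the number is
    -- reserved, but not yet readable.
    have h₁ := he R (x :: B) (.val x) v w M s hoke
      (Or.inr ⟨x, by simp, fun h => hR x h rfl, rfl⟩)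
      ⟨fun z hz => by simp [hs.sub z hz], hs.len,
        fun z hz => hs.val_nil z (by simp at hz; exact hz.2),
        fun z hz => hs.cnt_nil z (by simp at hz; exact hz.2), hs.data, hs.tmp, hs.cmpA, hs.cmpB,
        hs.flag⟩ hv hw
    have hrep := hs.bind hx ((e.eval v w).map some).reverse []
    -- No loop is involved, so the counter of `x` stays empty and its update disappears.
    rw [← hs.cnt_nil x hx, Function.update_eq_self, List.length_reverse, List.length_map] at hrep
    have h₀ : emit s (.val x) (e.eval v w) =
        Function.update s (.val x) ((e.eval v w).map some).reverse := by
      simp [emit, hs.val_nil x hx]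
    rw [h₀] at h₁
    have h₂ := hf (x :: R) (x :: B) t _ w (M + e.time M) _ hokf (ht.cons hx) hrep
      (fun z hz => by
        rcases eq_or_ne z x with rfl | hzx
        · simp; omega
        · have := hv z (by simpa [hzx] using hz)
          simp [hzx]; omega) (by omega)
    have h₃ := runLE_drain (Stk.val x) (emit (Function.update s (.val x)
      ((e.eval v w).map some).reverse) t
        (f.eval (Function.update v x (e.eval v w).length) w))
    have h₄ : Function.update (emit (Function.update s (.val x)
      ((e.eval v w).map some).reverse) t
        (f.eval (Function.update v x (e.eval v w).length) w)) (.val x) [] =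
        emit s t (eval (letLen x e f) v w) := by
      funext j
      by_cases hj : j = .val x
      · subst hj
        simp [emit, htx.symm, hs.val_nil x hx]
      · by_cases hj' : j = t
        · subst hj'
          simp [emit, htx, eval]
        · simp [emit, hj, hj']
    rw [h₄] at h₃
    refine (h₁.seq (h₂.seq h₃)).mono ?_
    simp only [time, emit, Function.update_of_ne htx.symm, Function.update_self,
      List.length_reverse, List.length_map]
    omega
  | ifEq x y e he =>
    intro R B t v w M s hok ht hs hv hw
    simp only [ok, Bool.and_eq_true, decide_eq_true_eq] at hok
    obtain ⟨⟨hx, hy⟩, hok⟩ := hok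
    have hlx := hs.len x hx
    have hly := hs.len y hy
    have hvx := hv x hx
    have hvy := hv y hy
    have h₁ := runLE_copy (k := .val x) (t := .cmpA) (by simp) (by simp) (by simp) hs.tmp
      (hlx.trans_le hvx)
    have h₂ := runLE_copy (k := .val y) (t := .cmpB) (n := M)
      (s := Function.update s .cmpA (s (.val x)).reverse) (by simp) (by simp) (by simp)
      (by simpa using hs.tmp) (by simpa using hly.trans_le hvy)
    simp only [ne_eq, reduceCtorEq, not_false_eq_true, Function.update_of_ne, hs.cmpA, hs.cmpB,
      List.append_nil] at h₁ h₂
    have h₃ := runLE_compare hs.flag hs.cmpA hs.cmpB (s (.val x)).reverse (s (.val y)).reverse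
      (n := M) (by simpa using hlx.trans_le hvx) (by simpa using hly.trans_le hvy)
    rw [List.length_reverse, List.length_reverse, hlx, hly] at h₃
    have h₄ : (pop .flag (e.compile t) fun _ => drain .flag).RunLE
        (Function.update s .flag (List.replicate ((v x - v y) + (v y - v x)) (some true)))
        (emit s t (eval (ifEq x y e) v w)) (e.time M + (4 * M + 2)) := by
      rcases eq_or_ne (v x) (v y) with hxy | hxy
      · have h := runLE_pop_nil (k := .flag) (q := fun _ => drain .flag) hs.flag
          (he R B t v w M s hok ht hs hv hw)
        have h₀ : Function.update s .flag [] = s := by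
          rw [← hs.flag, Function.update_eq_self]
        simp only [eval, hxy, Nat.sub_self, Nat.add_zero, List.replicate_zero, h₀, if_true]
        exact h.mono (by omega)
      · obtain ⟨m, hm⟩ : ∃ m, (v x - v y) + (v y - v x) = m + 1 :=
          Nat.exists_eq_add_one.2 (by omega)
        rw [hm]
        have h := runLE_pop_cons (k := .flag) (p := e.compile t) (q := fun _ => drain .flag)
          (s := Function.update s .flag (List.replicate (m + 1) (some true))) (a := some true)
          (l := List.replicate m (some true)) (by simp [List.replicate_succ])
          (runLE_drain Stk.flag _)
        have h₀ : Function.update s .flag [] = s := by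
          rw [← hs.flag, Function.update_eq_self]
        simp only [Function.update_idem, Function.update_self, List.length_replicate, h₀] at h
        simp only [eval, if_neg hxy, emit, List.map_nil, List.reverse_nil, List.nil_append,
          Function.update_eq_self]
        exact h.mono (by omega)
    -- The comparison is proved as one composite program, whereas the compiled code nests to the
    -- right; its run is split to reassociate.
    obtain ⟨t₃, ht₃, hr₃⟩ := h₃
    cases hr₃ with
    | @seq _ _ _ s' _ a b ha hb =>
      obtain ⟨t₁, ht₁, hr₁⟩ := h₁
      obtain ⟨t₂, ht₂, hr₂⟩ := h₂
      obtain ⟨t₄, ht₄, hr₄⟩ := h₄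
      refine ⟨_, ?_, .seq hr₁ (.seq hr₂ (.seq ha (.seq hb hr₄)))⟩
      simp only [time]
      omega

end Gen

end GrundyW

/-! ### Reading instances, and FPT reductions from expressions -/

namespace GrundyW

open Prog

namespace Gen

/-- The number of leading `true`s. -/
def head (x : List Bool) : ℕ := (x.takeWhile id).length

/-- What follows the leading `true`s. -/
def rest (x : List Bool) : List Bool := x.dropWhile id

/-- The numbers that are read off from an instance: the parameter, the number of leading `true`s of
the word, and the length of the rest of the word. -/
def startEnv (p : List Bool × ℕ) (x : Var) : ℕ :=
  if x = 0 then p.2 else if x = 1 then head p.1 else if x = 2 then (rest p.1).length else 0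

/-- Reads an instance. -/
def parse : Prog Stk (Option Bool) :=
  Prog.loop Stk.inp fun a => match a with
    | none => push (.val 0) (some true)
    | some true => pop .tmp (push (.val 1) (some true)) fun b =>
        pushAll .tmp [b, some true] |>.seq (push (.val 2) (some true))
    | some false => seq (push .tmp (some false)) (push (.val 2) (some true))

/-- The stacks after `i` symbols of `l` have been read. -/
def parseStk (l : List (Option Bool)) (i : ℕ) : Stk → List (Option Bool)
  | .inp => l.drop i
  | .tmp => ((rest (l.take i).reduceOption).map some).reverse
  | .val x => List.replicate (startEnv ((l.take i).reduceOption, (l.take i).count none) x) (some true)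
  | _ => []

/-- A new bit counts towards the leading `true`s exactly if it is `true` and `rest` is still empty.
The following lemmas treat the cases in turn. -/
theorem rest_append_true {y : List Bool} (h : rest y = []) : rest (y ++ [true]) = [] := by
  rw [rest] at h
  simp [rest, List.dropWhile_append, h]

theorem head_append_true {y : List Bool} (h : rest y = []) :
    head (y ++ [true]) = head y + 1 := by
  have := List.takeWhile_append_dropWhile (p := id) (l := y)
  rw [rest] at h
  rw [h, List.append_nil] at this
  simp [head, List.takeWhile_append, this]

theorem rest_append_of_ne {y : List Bool} (h : rest y ≠ []) (b : Bool) :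
    rest (y ++ [b]) = rest y ++ [b] := by
  rw [rest] at h
  simp [rest, List.dropWhile_append, h]

theorem rest_append_false (y : List Bool) : rest (y ++ [false]) = rest y ++ [false] := by
  by_cases h : rest y = []
  · rw [rest] at h
    simp [rest, List.dropWhile_append, h]
  · exact rest_append_of_ne h _

theorem head_append_of_ne {y : List Bool} (h : rest y ≠ []) (b : Bool) :
    head (y ++ [b]) = head y := by
  have := congrArg List.length (List.takeWhile_append_dropWhile (p := id) (l := y))
  rw [rest] at h
  have h' : (y.takeWhile id).length ≠ y.length := by
    rw [List.length_append] at this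
    have := List.length_pos_of_ne_nil h
    omega
  simp [head, List.takeWhile_append, h']

theorem head_append_false (y : List Bool) : head (y ++ [false]) = head y := by
  by_cases h : rest y = []
  · have := List.takeWhile_append_dropWhile (p := id) (l := y)
    rw [rest] at h
    rw [h, List.append_nil] at this
    simp [head, List.takeWhile_append, this]
  · exact head_append_of_ne h _

/-- The stack `tmp` holds the part of the word read after the leading `true`s, so whether it is
empty tells if the next `true` is still a leading one. The test pops a symbol, which is put back. -/
theorem runLE_parse (l : List (Option Bool)) :
    parse.RunLE (parseStk l 0) (parseStk l l.length) (6 * l.length + 1) := by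
  refine runLE_loop l (parseStk l) (fun i _ => rfl) fun i hi => ?_
  have ht : l.take (i + 1) = l.take i ++ [l[i]] := (List.take_append_getElem hi).symm
  obtain ha | ha | ha : l[i] = none ∨ l[i] = some true ∨ l[i] = some false := by
    rcases l[i] with _ | _ | _ <;> simp
  · rw [ha] at ht ⊢
    refine RunLE.mono (T := 1) ?_ (by omega)
    convert runLE_push (K := Stk) (A := Option Bool) _ _ _ using 1
    funext j
    cases j with
    | val x =>
      by_cases hx : x = 0
      · subst hx
        simp [parseStk, ht, startEnv, List.replicate_succ, List.count_append]
      · simp [parseStk, ht, startEnv, hx, List.reduceOption_append]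
    | _ => simp [parseStk, ht, List.reduceOption_append]
  · rw [ha] at ht ⊢
    by_cases hr : rest (l.take i).reduceOption = []
    · refine RunLE.mono (T := 1 + 1) (runLE_pop_nil (by simp [parseStk, hr]) ?_) (by omega)
      convert runLE_push (K := Stk) (A := Option Bool) _ _ _ using 1
      funext j
      have hr' := rest_append_true hr
      have hh := head_append_true hr
      cases j with
      | val x =>
        by_cases hx : x = 1
        · subst hx
          simp [parseStk, ht, startEnv, List.replicate_succ, List.reduceOption_append, hh]
        · simp [parseStk, ht, startEnv, hx, List.reduceOption_append, hr, hr', List.count_append]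
      | _ => simp [parseStk, ht, List.reduceOption_append, hr, hr']
    · obtain ⟨a, y, hy⟩ := List.exists_cons_of_ne_nil
        (show ((rest (l.take i).reduceOption).map some).reverse ≠ [] by simpa using hr)
      refine RunLE.mono (T := (3 + 1) + 1)
        (runLE_pop_cons (a := a) (l := y) (by simpa [parseStk] using hy)
          ?_) (by omega)
      convert (runLE_pushAll (K := Stk) (A := Option Bool) _ _ _).seq (runLE_push _ _ _) using 1
      on_goal 2 => rfl
      funext j
      have hr' := rest_append_of_ne hr true
      have hh := head_append_of_ne hr true
      cases j with
      | val x =>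
        by_cases hx : x = 2
        · subst hx
          simp [parseStk, ht, startEnv, List.replicate_succ, List.reduceOption_append, hr']
        · simp [parseStk, ht, startEnv, hx, List.reduceOption_append, hh, List.count_append]
      | tmp => simp [parseStk, ht, List.reduceOption_append, hr', ← hy]
      | _ => simp [parseStk]
  · rw [ha] at ht ⊢
    refine RunLE.mono (T := 1 + 1) ?_ (by omega)
    convert (runLE_push (K := Stk) (A := Option Bool) _ _ _).seq (runLE_push _ _ _) using 1
    funext j
    have hr' := rest_append_false (l.take i).reduceOption
    have hh := head_append_false (l.take i).reduceOption
    cases j with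
    | val x =>
      by_cases hx : x = 2
      · subst hx
        simp [parseStk, ht, startEnv, List.replicate_succ, List.reduceOption_append, hr']
      · simp [parseStk, ht, startEnv, hx, List.reduceOption_append, hh, List.count_append]
    | tmp => simp [parseStk, ht, List.reduceOption_append, hr']
    | _ => simp [parseStk]

/-- Reads an instance, evaluates the expression, and doubles the parameter. -/
def program (e : Gen) : Prog Stk (Option Bool) :=
  seq parse <| seq (move .tmp .data) <| seq (e.compile .res) <| seq (move .res .out) <|
  seq (Prog.loop (.val 0) fun _ => pushAll .out [none, none]) <| seq (drain (.val 1)) <|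
  seq (drain (.val 2)) (drain .data)

/-- The map on instances that an expression describes. -/
def reduction (e : Gen) (p : List Bool × ℕ) : List Bool × ℕ :=
  (e.eval (startEnv p) (rest p.1), 2 * p.2)

theorem runLE_program {e : Gen} (he : e.ok [0, 1, 2] [0, 1, 2]) (p : List Bool × ℕ) {N : ℕ}
    (hN : (instanceWord p).length = N) :
    e.program.RunLE (Function.update (fun _ => []) .inp (instanceWord p))
      (Function.update (fun _ => []) .out (instanceWord (e.reduction p)))
      (17 * N + 3 * e.time N + 8) := by
  have hle : p.2 + p.1.length = N := by simpa [instanceWord] using hN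
  have hred : (instanceWord p).reduceOption = p.1 := by
    simp [instanceWord, List.reduceOption_append, List.reduceOption_replicate_none]
    induction p.1 with
    | nil => rfl
    | cons a l ih => simp [List.reduceOption_cons_of_some, ih]
  have hcount : (instanceWord p).count none = p.2 := by
    simp [instanceWord, List.count_append, List.count_eq_zero]
  have h₁ := runLE_parse (instanceWord p)
  have hs₀ : parseStk (instanceWord p) 0 =
      Function.update (fun _ => []) .inp (instanceWord p) := by
    funext j
    cases j with
    | val x => simp [parseStk, startEnv, head, rest]
    | _ => simp [parseStk, rest]
  rw [hs₀] at h₁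
  have hrl : (rest p.1).length ≤ p.1.length := (List.dropWhile_suffix _).length_le
  have hhl : head p.1 ≤ p.1.length := (List.takeWhile_prefix _).length_le
  let s : Stk → List (Option Bool) := fun j => match j with
    | .data => (rest p.1).map some
    | .val x => List.replicate (startEnv p x) (some true)
    | _ => []
  -- Reading the word has reversed it; this move brings its first symbol back to the top. The move
  -- from `res` to `out` does the same for the result.
  have h₂ := runLE_move (k := Stk.tmp) (d := .data) (by simp)
    (parseStk (instanceWord p) (instanceWord p).length)
  have hs₂ : Function.update (Function.update (parseStk (instanceWord p) (instanceWord p).length)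
      .tmp []) .data ((parseStk (instanceWord p) (instanceWord p).length .tmp).reverse ++
      parseStk (instanceWord p) (instanceWord p).length .data) = s := by
    funext j
    cases j <;> simp [parseStk, s, hred, hcount]
  have ht₂ : (parseStk (instanceWord p) (instanceWord p).length .tmp).length =
      (rest p.1).length := by
    simp [parseStk, hred]
  rw [hs₂, ht₂] at h₂
  have hrep : Rep [0, 1, 2] [0, 1, 2] (startEnv p) (rest p.1) s :=
    ⟨fun x hx => hx, fun x _ => by simp [s], fun x hx => by
      simp only [List.mem_cons, List.not_mem_nil, or_false, not_or] at hx
      simp [s, startEnv, hx], fun x _ => rfl, rfl, rfl, rfl, rfl, rfl⟩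
  have hv : ∀ x ∈ ([0, 1, 2] : List Var), startEnv p x ≤ N := by
    intro x hx
    simp only [startEnv]
    split_ifs <;> omega
  have h₃ := runLE_compile e [0, 1, 2] [0, 1, 2] .res (startEnv p) (rest p.1) N s he (Or.inl rfl)
    hrep hv (by omega)
  have hl := length_eval_le e [0, 1, 2] [0, 1, 2] (startEnv p) (rest p.1) N he hv (by omega)
  set y := e.eval (startEnv p) (rest p.1) with hy
  have h₄ := runLE_move (k := Stk.res) (d := .out) (by simp) (emit s .res y)
  have hs₄ : Function.update (Function.update (emit s .res y) .res []) .out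
      ((emit s .res y .res).reverse ++ emit s .res y .out) =
      Function.update s .out (y.map some) := by
    funext j
    cases j <;> simp [emit, s]
  have ht₄ : (emit s .res y .res).length = y.length := by simp [emit, s]
  rw [hs₄, ht₄] at h₄
  have h₅ := runLE_loop (k := Stk.val 0) (q := fun _ => pushAll .out [none, none]) (T := 3)
    (List.replicate p.2 (some true))
    (fun i => Function.update (Function.update s (.val 0)
      ((List.replicate p.2 (some true)).drop i)) .out
        (List.replicate (2 * i) none ++ y.map some)) (fun i _ => by simp)
    (fun i hi => by
      convert runLE_pushAll (K := Stk) (A := Option Bool) _ _ _ using 1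
      on_goal 2 => rfl
      funext j
      cases j <;> simp [Function.update_apply, Nat.mul_add, List.replicate_succ]
      split_ifs <;> rfl)
  have hs₅ : Function.update (Function.update s (.val 0)
      ((List.replicate p.2 (some true)).drop 0)) .out
        (List.replicate (2 * 0) none ++ y.map some) = Function.update s .out (y.map some) := by
    funext j
    by_cases h0 : j = .val 0
    · subst h0; simp [s, startEnv]
    · by_cases h1 : j = .out
      · subst h1; simp
      · simp [h0, h1]
  rw [hs₅] at h₅
  simp only [List.length_replicate] at h₅
  have h₆ := runLE_drain (Stk.val 1) (Function.update (Function.update s (.val 0)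
      ((List.replicate p.2 (some true)).drop p.2)) .out
        (List.replicate (2 * p.2) none ++ y.map some))
  have h₇ := runLE_drain (Stk.val 2) (Function.update (Function.update (Function.update s (.val 0)
      ((List.replicate p.2 (some true)).drop p.2)) .out
        (List.replicate (2 * p.2) none ++ y.map some)) (.val 1) [])
  have h₈ := runLE_drain Stk.data (Function.update (Function.update (Function.update
    (Function.update s (.val 0) ((List.replicate p.2 (some true)).drop p.2)) .out
        (List.replicate (2 * p.2) none ++ y.map some)) (.val 1) []) (.val 2) [])
  have hs₈ : Function.update (Function.update (Function.update (Function.update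
      (Function.update s (.val 0) ((List.replicate p.2 (some true)).drop p.2)) .out
        (List.replicate (2 * p.2) none ++ y.map some)) (.val 1) []) (.val 2) []) .data [] =
      Function.update (fun _ => []) .out (instanceWord (e.reduction p)) := by
    funext j
    cases j with
    | val x =>
      by_cases h0 : x = 0
      · subst h0; simp
      · by_cases h1 : x = 1
        · subst h1; simp
        · by_cases h2 : x = 2
          · subst h2; simp
          · simp [h0, h1, h2, s, startEnv]
    | out => simp [instanceWord, reduction, hy]
    | _ => simp [s]
  rw [hs₈] at h₈
  refine (h₁.seq <| h₂.seq <| h₃.seq <| h₄.seq <| h₅.seq <| h₆.seq <| h₇.seq h₈).mono ?_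
  simp only [ne_eq, reduceCtorEq, not_false_eq_true, Function.update_of_ne, Stk.val.injEq,
    Fin.reduceEq, s, List.length_replicate, List.length_map, hN]
  have e₁ : startEnv p 1 = head p.1 := rfl
  have e₂ : startEnv p 2 = (rest p.1).length := rfl
  rw [e₁, e₂]
  omega

theorem _root_.Polynomial.exists_eval_le (p : Polynomial ℕ) :
    ∃ c d : ℕ, ∀ M, p.eval M ≤ c * (M + 1) ^ d := by
  induction p using Polynomial.induction_on' with
  | add p q hp hq =>
    obtain ⟨c, d, h⟩ := hp
    obtain ⟨c', d', h'⟩ := hq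
    refine ⟨c + c', d + d', fun M => ?_⟩
    rw [Polynomial.eval_add, add_mul]
    have h₁ : (M + 1) ^ d ≤ (M + 1) ^ (d + d') := Nat.pow_le_pow_right (by omega) (by omega)
    have h₂ : (M + 1) ^ d' ≤ (M + 1) ^ (d + d') := Nat.pow_le_pow_right (by omega) (by omega)
    exact add_le_add ((h M).trans (Nat.mul_le_mul_left _ h₁))
      ((h' M).trans (Nat.mul_le_mul_left _ h₂))
  | monomial n a =>
    refine ⟨a, n, fun M => ?_⟩
    rw [Polynomial.eval_monomial]
    exact Nat.mul_le_mul_left _ (Nat.pow_le_pow_left (by omega) _)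

/-- The time is polynomial with no dependence on the parameter beyond the input length, so `f` is
constant, and the new parameter is `2k`. -/
theorem fptReducible {e : Gen} (he : e.ok [0, 1, 2] [0, 1, 2]) {L₁ L₂ : ParamProblem}
    (h : ∀ p, p ∈ L₁ ↔ e.reduction p ∈ L₂) : FPTReducible L₁ L₂ := by
  obtain ⟨q, hq⟩ := e.exists_polynomial
  -- The constant is 9 instead of 8 because of the halting step.
  obtain ⟨c, d, hcd⟩ := (17 * Polynomial.X + 3 * q + 9 : Polynomial ℕ).exists_eval_le
  refine ⟨e.reduction, h, ⟨fun k => 2 * k, ?_, fun p => le_rfl⟩, Prog.machine e.program .inp .out,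
    fun _ => c, d, Computable.const c, fun p => ?_⟩
  · exact (Primrec.nat_mul.comp (Primrec.const 2) Primrec.id).to_comp
  · obtain ⟨t, ht, hr⟩ := runLE_program he p rfl
    refine hr.outputsInTime ?_
    refine le_trans ?_ (hcd _)
    simp only [Polynomial.eval_add, Polynomial.eval_mul, Polynomial.eval_ofNat,
      Polynomial.eval_X, ← hq]
    omega

end Gen

end GrundyW

namespace GrundyW

/-! ### Encodings of circuits -/

/-- No codeword is a proper prefix of another one. -/
def SelfDelimiting {α : Type*} (e : α → List Bool) : Prop :=
  ∀ a b u v, e a ++ u = e b ++ v → a = b ∧ u = v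

theorem selfDelimiting_encodeNat : SelfDelimiting encodeNat := by
  intro a
  induction a with
  | zero =>
    intro b u v h
    cases b with
    | zero => simpa [encodeNat] using h
    | succ b => simp [encodeNat, List.replicate_succ] at h
  | succ a ih =>
    intro b u v h
    cases b with
    | zero => simp [encodeNat, List.replicate_succ] at h
    | succ b =>
      obtain ⟨h₁, h₂⟩ := ih b u v (by simpa [encodeNat, List.replicate_succ] using h)
      exact ⟨by rw [h₁], h₂⟩

/-- The bit in front of each entry decides whether the list goes on, and then the entry can be split
off. -/
theorem SelfDelimiting.encodeList {α : Type*} {e : α → List Bool} (he : SelfDelimiting e) :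
    SelfDelimiting (encodeList e) := by
  intro a
  induction a with
  | nil =>
    intro b u v h
    cases b with
    | nil => simpa [GrundyW.encodeList] using h
    | cons y b => simp [GrundyW.encodeList] at h
  | cons x a ih =>
    intro b u v h
    cases b with
    | nil => simp [GrundyW.encodeList] at h
    | cons y b =>
      obtain ⟨h₁, h₂⟩ := he x y (GrundyW.encodeList e a ++ u) (GrundyW.encodeList e b ++ v)
        (by simpa [GrundyW.encodeList] using h)
      obtain ⟨h₃, h₄⟩ := ih b u v h₂
      exact ⟨by rw [h₁, h₃], h₄⟩

theorem selfDelimiting_encodeGate : SelfDelimiting Gate.encode := by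
  rintro ⟨a, l⟩ ⟨b, l'⟩ u v h
  simp only [Gate.encode, List.cons_append, List.cons.injEq] at h
  obtain ⟨h₁, h₂⟩ := h
  have hw : SelfDelimiting fun w : Bool × ℕ => w.1 :: encodeNat w.2 := by
    rintro ⟨a, i⟩ ⟨b, j⟩ u v h
    simp only [List.cons_append, List.cons.injEq] at h
    obtain ⟨h₃, h₄⟩ := selfDelimiting_encodeNat i j u v h.2
    exact ⟨by rw [h.1, h₃], h₄⟩
  obtain ⟨h₃, h₄⟩ := hw.encodeList _ _ _ _ h₂
  exact ⟨by rw [h₁, h₃], h₄⟩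

/-- The encoding of a circuit with `V` variables and the gates `l`. -/
def encodeGates (V : ℕ) (l : List Gate) : List Bool := encodeNat V ++ encodeList Gate.encode l

/-- `WCS` only asserts that some circuit has the given code. Injectivity identifies it with the
constructed one. -/
theorem encodeGates_injective {V V' : ℕ} {l l' : List Gate}
    (h : encodeGates V l = encodeGates V' l') : V = V' ∧ l = l' := by
  obtain ⟨h₁, h₂⟩ := selfDelimiting_encodeNat _ _ _ _ h
  refine ⟨h₁, (selfDelimiting_encodeGate.encodeList l l' [] [] ?_).1⟩
  rw [h₂]

/-- Every code contains the terminator of its number of variables. The empty word thus serves as the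
no-instance for malformed inputs. -/
theorem nil_notMem_WCS (t d k : ℕ) : (([], k) : List Bool × ℕ) ∉ WCS t d := by
  rintro ⟨C, hC, -⟩
  simp [Circuit.encode, encodeNat] at hC

/-! ### Formulas in conjunctive normal form with constants -/

/-- The formula with the clauses `L` is true if the nodes have the values `τ`. -/
def Sat (τ : ℕ → Bool) (L : List (List (Bool × ℕ))) : Prop :=
  ∀ l ∈ L, ∃ w ∈ l, xor w.1 (τ w.2) = true

/-- The values of the variables and of the constants `w`. -/
def nodeValue (V : ℕ) (w : List Bool) (a : ℕ → Bool) (i : ℕ) : Bool :=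
  if i < V then a i else w.getD (i - V) false

/-- The gates of the circuit for the formula with the clauses `L` over `V` variables, in which the
nodes `V, V + 1, …` are the constants from `w`. -/
def cnfGates (V : ℕ) (w : List Bool) (L : List (List (Bool × ℕ))) : List Gate :=
  w.map (fun b => ⟨b, []⟩) ++ (L.map (fun l => ⟨false, l⟩) ++
    [⟨true, (List.range L.length).map fun i => (false, V + (w.length + i))⟩])

section CNF

variable {V : ℕ} {w : List Bool} {L : List (List (Bool × ℕ))}

theorem length_cnfGates : (cnfGates V w L).length = w.length + L.length + 1 := by
  simp [cnfGates, add_assoc]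

theorem cnfGates_const {j : ℕ} (hj : j < w.length) (h : j < (cnfGates V w L).length) :
    (cnfGates V w L)[j] = ⟨w[j], []⟩ := by
  simp [cnfGates, hj]

theorem cnfGates_clause {j : ℕ} (hj : j < L.length)
    (h : w.length + j < (cnfGates V w L).length) :
    (cnfGates V w L)[w.length + j] = ⟨false, L[j]⟩ := by
  simp [cnfGates, hj]

theorem cnfGates_out (h : w.length + L.length < (cnfGates V w L).length) :
    (cnfGates V w L)[w.length + L.length] =
      ⟨true, (List.range L.length).map fun i => (false, V + (w.length + i))⟩ := by
  simp [cnfGates]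

/-- The circuit for a formula in conjunctive normal form. -/
def cnfCircuit (V : ℕ) (w : List Bool) (L : List (List (Bool × ℕ)))
    (hL : ∀ l ∈ L, ∀ x ∈ l, x.2 < V + w.length) : Circuit where
  vars := V
  gates := cnfGates V w L
  gates_ne_nil := by simp [cnfGates]
  acyclic := by
    intro j hj x hx
    rw [length_cnfGates] at hj
    rcases Nat.lt_or_ge j w.length with h₁ | h₁
    · rw [cnfGates_const h₁] at hx
      simp at hx
    · obtain ⟨i, rfl⟩ := Nat.exists_eq_add_of_le h₁
      rcases Nat.lt_or_ge i L.length with h₂ | h₂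
      · rw [cnfGates_clause h₂] at hx
        have := hL _ (List.getElem_mem h₂) x hx
        omega
      · obtain rfl : i = L.length := by omega
        rw [cnfGates_out] at hx
        simp only [List.mem_map, List.mem_range] at hx
        obtain ⟨m, hm, rfl⟩ := hx
        simp only
        omega

/-- The ranks `f` along the chain are distinct numbers below `m`. -/
theorem length_le_of_isChain {α : Type*} {R : α → α → Prop} {p : List α}
    (hp : p.IsChain R) (f : α → ℕ) (m : ℕ) (hf : ∀ a b, R a b → f a < f b) (hm : ∀ a, f a < m) :
    p.length ≤ m := by
  have h : (p.map f).IsChain (· < ·) := by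
    rw [List.isChain_map]
    exact hp.imp fun a b h => hf a b h
  have hn : (p.map f).Nodup := (List.isChain_iff_pairwise.1 h).imp fun h => h.ne
  have hs : (p.map f).toFinset ⊆ Finset.range m := by
    intro x hx
    simp only [List.mem_toFinset, List.mem_map] at hx
    obtain ⟨a, -, rfl⟩ := hx
    simpa using hm a
  have := Finset.card_le_card hs
  rwa [List.toFinset_card_of_nodup hn, List.length_map, Finset.card_range] at this

/-- The layer of a gate. -/
def cnfLayer (w : List Bool) (L : List (List (Bool × ℕ))) (j : ℕ) : ℕ :=
  if j < w.length then 0 else if j < w.length + L.length then 1 else 2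

theorem cnfLayer_lt (hL : ∀ l ∈ L, ∀ x ∈ l, x.2 < V + w.length) (i j : ℕ)
    (hj : j < (cnfGates V w L).length) (x : Bool × ℕ) (hx : x ∈ ((cnfGates V w L)[j]'hj).inputs)
    (hxi : x.2 = V + i) : cnfLayer w L i < cnfLayer w L j := by
  have hj' := hj
  rw [length_cnfGates] at hj'
  simp only [cnfLayer]
  rcases Nat.lt_or_ge j w.length with h₁ | h₁
  · rw [cnfGates_const h₁] at hx
    simp at hx
  · obtain ⟨m, rfl⟩ := Nat.exists_eq_add_of_le h₁
    rcases Nat.lt_or_ge m L.length with h₂ | h₂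
    · rw [cnfGates_clause h₂] at hx
      have := hL _ (List.getElem_mem h₂) x hx
      rw [if_pos (by omega), if_neg (by omega), if_pos (by omega)]
      omega
    · obtain rfl : m = L.length := by omega
      rw [cnfGates_out] at hx
      simp only [List.mem_map, List.mem_range] at hx
      obtain ⟨m, hm, rfl⟩ := hx
      simp only at hxi
      rw [if_neg (by omega), if_pos (by omega), if_neg (by omega), if_neg (by omega)]
      omega

theorem depthLE_cnfCircuit (hL : ∀ l ∈ L, ∀ x ∈ l, x.2 < V + w.length) :
    (cnfCircuit V w L hL).DepthLE 3 := by
  rintro p ⟨hp, -⟩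
  refine length_le_of_isChain hp (fun j => cnfLayer w L j) 3 ?_
    (fun j => by simp only [cnfLayer]; split_ifs <;> omega)
  rintro ⟨i, hi⟩ ⟨j, hj⟩ ⟨x, hx, hxi⟩
  exact cnfLayer_lt hL i j hj x hx hxi

/-- A gate without inputs evaluates to its type, AND to true and OR to false, so the constants take
the bits of `w`. A true output forces every clause gate to be true. -/
theorem sat_of_isValuation {v : ℕ → Bool}
    (hv : ∀ (j : ℕ) (hj : j < (cnfGates V w L).length),
      v (V + j) = ((cnfGates V w L)[j]).value v)
    (ho : v (V + (w.length + L.length)) = true)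
    (hL : ∀ l ∈ L, ∀ x ∈ l, x.2 < V + w.length) :
    Sat (nodeValue V w v) L := by
  have hnode : ∀ i < V + w.length, nodeValue V w v i = v i := by
    intro i hi
    rw [nodeValue]
    split_ifs with h
    · rfl
    · obtain ⟨m, rfl⟩ := Nat.exists_eq_add_of_le (not_lt.1 h)
      have hm : m < w.length := by omega
      rw [hv m (by rw [length_cnfGates]; omega), cnfGates_const hm]
      simp only [Nat.add_sub_cancel_left, Gate.value, List.all_nil, List.any_nil]
      rw [List.getD_eq_getElem _ _ hm]
      cases w[m] <;> rfl
  rw [hv _ (by rw [length_cnfGates]; omega), cnfGates_out] at ho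
  simp only [Gate.value, if_true, List.all_eq_true, List.mem_map, List.mem_range,
    forall_exists_index, and_imp] at ho
  intro l hl
  obtain ⟨m, hm, rfl⟩ := List.getElem_of_mem hl
  have h := ho _ m hm rfl
  simp only [Bool.false_bne] at h
  rw [hv _ (by rw [length_cnfGates]; omega), cnfGates_clause hm] at h
  simp only [Gate.value, Bool.false_eq_true, if_false, List.any_eq_true] at h
  obtain ⟨x, hx, hxv⟩ := h
  exact ⟨x, hx, by rw [hnode _ (hL _ hl x hx)]; exact hxv⟩

theorem mem_WCS_cnfGates (hL : ∀ l ∈ L, ∀ x ∈ l, x.2 < V + w.length) (k : ℕ) :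
    (encodeGates V (cnfGates V w L), k) ∈ WCS 3 3 ↔
      ∃ a : ℕ → Bool, ((Finset.range V).filter fun i => a i = true).card = k ∧
        Sat (nodeValue V w a) L := by
  have hcard : ∀ a : ℕ → Bool, ((Finset.range V).filter fun i => a i = true).card =
      (Finset.univ.filter fun i : Fin V => a i = true).card := by
    intro a
    rw [Finset.card_filter, Finset.card_filter, Finset.sum_range]
  constructor
  · rintro ⟨C, hC, -, -, a, ⟨v, ⟨hva, hv⟩, ho⟩, ha⟩
    obtain ⟨V', gs, hne, hac⟩ := C
    -- The witness circuit has the constructed variables and gates.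
    obtain ⟨rfl, rfl⟩ := encodeGates_injective (V := V) (l := cnfGates V w L) hC
    refine ⟨v, ?_, sat_of_isValuation hv ?_ hL⟩
    · rw [hcard]
      simp only at hva
      simp only [hva]
      exact ha
    · have : Circuit.outGate ⟨V, cnfGates V w L, hne, hac⟩ = w.length + L.length := by
        simp [Circuit.outGate, length_cnfGates]
      rw [← this]
      exact ho
  · rintro ⟨a, ha, hs⟩
    have hd := depthLE_cnfCircuit hL
    -- The weft is bounded by the depth: a path has no more large gates than gates.
    refine ⟨cnfCircuit V w L hL, rfl, fun p hp => List.countP_le_length.trans (hd p hp), hd,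
      fun i => a i, ?_, ?_⟩
    -- Beyond variables and constants, a node gets the value of its clause. At the output gate the
    -- lookup in `L` returns `none`, and the quantifier is vacuously true.
    · let v : ℕ → Bool := fun i => if i < V + w.length then nodeValue V w a i else
        decide (∀ l ∈ L[i - V - w.length]?, ∃ x ∈ l, xor x.1 (nodeValue V w a x.2) = true)
      have hvn : ∀ i < V + w.length, v i = nodeValue V w a i := fun i hi => if_pos hi
      have hvc : ∀ (i : ℕ) (hi : i < L.length), v (V + (w.length + i)) = true := by
        intro i hi
        have : ¬ V + (w.length + i) < V + w.length := by omega
        simp only [v, if_neg this, decide_eq_true_eq]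
        intro l hl
        exact hs l (List.mem_of_getElem? (Option.mem_def.1 hl))
      have hvo : v (V + (w.length + L.length)) = true := by
        have : ¬ V + (w.length + L.length) < V + w.length := by omega
        simp [v, if_neg this]
      refine ⟨v, ⟨fun i => ?_, fun j hj => ?_⟩, ?_⟩
      · have := i.2
        change (i : ℕ) < V at this
        rw [hvn _ (by omega), nodeValue, if_pos this]
      · change v (V + j) = ((cnfGates V w L)[j]'hj).value v
        change j < (cnfGates V w L).length at hj
        have hj' := hj
        rw [length_cnfGates] at hj'
        rcases Nat.lt_or_ge j w.length with h₁ | h₁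
        · rw [cnfGates_const h₁, hvn _ (by omega), nodeValue, if_neg (by omega),
            Nat.add_sub_cancel_left, List.getD_eq_getElem _ _ h₁]
          simp only [Gate.value, List.all_nil, List.any_nil]
          cases w[j] <;> rfl
        · obtain ⟨m, rfl⟩ := Nat.exists_eq_add_of_le h₁
          rcases Nat.lt_or_ge m L.length with h₂ | h₂
          · rw [cnfGates_clause h₂, hvc m h₂]
            obtain ⟨x, hx, hxv⟩ := hs _ (List.getElem_mem h₂)
            symm
            simp only [Gate.value, Bool.false_eq_true, if_false, List.any_eq_true]
            exact ⟨x, hx, by rw [hvn _ (hL _ (List.getElem_mem h₂) x hx)]; exact hxv⟩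
          · obtain rfl : m = L.length := by omega
            rw [cnfGates_out, hvo]
            symm
            simp only [Gate.value, if_true, List.all_eq_true, List.mem_map, List.mem_range,
              forall_exists_index, and_imp]
            rintro _ i hi rfl
            simpa using hvc i hi
      · have : (cnfCircuit V w L hL).outGate = w.length + L.length := by
          simp [Circuit.outGate, cnfCircuit, length_cnfGates]
        rw [this]
        exact hvo
    · rw [← ha, hcard]
      rfl

end CNF

end GrundyW

namespace GrundyW

/-! ### Uniform families of formulas -/

/-- Summands of the number of a node. -/
inductive Atom : Type
  | const (m : ℕ)
  | var (x : Var)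
  | mul (x y : Var) (h : y ≠ 15 := by decide)

namespace Atom

def eval (v : Var → ℕ) : Atom → ℕ
  | const m => m
  | var x => v x
  | mul x y _ => v x * v y

/-- The expression for a number in unary. -/
def gen : Atom → Gen
  | const m => .lit (List.replicate m true)
  | var x => .ones x
  | mul x y _ => .loop 15 x (.ones y)

/-- A product is a loop over copies of `y`, run with the bound number 15. Hence `y` must differ from
15 to escape capture; `x` is read before the binding. -/
theorem eval_gen (a : Atom) (v : Var → ℕ) (w : List Bool) :
    a.gen.eval v w = List.replicate (a.eval v) true := by
  cases a with
  | const m => rfl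
  | var x => rfl
  | mul x y h =>
    simp only [gen, Gen.eval, eval, Function.update_of_ne h]
    induction v x with
    | zero => simp
    | succ m ih =>
      rw [List.range_succ, List.flatMap_append, ih, Nat.succ_mul, List.replicate_add]
      simp

end Atom

/-- The number of a node. -/
def address (v : Var → ℕ) (l : List Atom) : ℕ := (l.map (Atom.eval v)).sum

/-- The expression for the number of a node in unary. -/
def addressGen (l : List Atom) : Gen := l.foldr (fun a e => .app a.gen e) (.lit [])

theorem eval_addressGen (l : List Atom) (v : Var → ℕ) (w : List Bool) :
    (addressGen l).eval v w = List.replicate (address v l) true := by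
  induction l with
  | nil => rfl
  | cons a l ih =>
    change a.gen.eval v w ++ (addressGen l).eval v w = _
    rw [ih, a.eval_gen, ← List.replicate_add]
    simp [address]

/-- Families of clauses. A literal is a sign, which is `true` for a negated node, and the number of
a node. -/
inductive Cls : Type
  /-- a single clause -/
  | clause (l : List (Bool × List Atom))
  /-- the clause that consists of the positive literals with the given node for all `x < r` -/
  | block (x r : Var) (l : List Atom)
  | app (c d : Cls)
  /-- all clauses for all `x < r` -/
  | loop (x r : Var) (c : Cls)

namespace Cls

def eval : Cls → (Var → ℕ) → List (List (Bool × ℕ))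
  | clause l, v => [l.map fun p => (p.1, address v p.2)]
  | block x r l, v => [(List.range (v r)).map fun i => (false, address (Function.update v x i) l)]
  | app c d, v => c.eval v ++ d.eval v
  | loop x r c, v => (List.range (v r)).flatMap fun i => c.eval (Function.update v x i)

/-- The encodings of a literal. -/
def literalGen (b : Bool) (l : List Atom) : Gen :=
  .app (.lit [true, b]) (.app (addressGen l) (.lit [false]))

/-- The encodings of the gates for the clauses, each preceded by `true`. -/
def gen : Cls → Gen
  | clause l => .app (.lit [true, false])
      (l.foldr (fun p e => .app (literalGen p.1 p.2) e) (.lit [false]))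
  | block x r l => .app (.lit [true, false]) (.app (.loop x r (literalGen false l)) (.lit [false]))
  | app c d => .app c.gen d.gen
  | loop x r c => .loop x r c.gen

/-- The number of clauses in unary. -/
def count : Cls → Gen
  | clause _ => .lit [true]
  | block _ _ _ => .lit [true]
  | app c d => .app c.count d.count
  | loop x r c => .loop x r c.count

theorem eval_literalGen (b : Bool) (l : List Atom) (v : Var → ℕ) (w : List Bool) :
    (literalGen b l).eval v w = true :: (b :: encodeNat (address v l)) := by
  simp [literalGen, Gen.eval, eval_addressGen, encodeNat]

theorem eval_gen (c : Cls) : ∀ (v : Var → ℕ) (w : List Bool),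
    c.gen.eval v w = (c.eval v).flatMap fun l => true :: Gate.encode ⟨false, l⟩ := by
  induction c with
  | clause l =>
    intro v w
    have h : ∀ l : List (Bool × List Atom),
        (l.foldr (fun p e => Gen.app (literalGen p.1 p.2) e) (.lit [false])).eval v w =
          encodeList (fun w : Bool × ℕ => w.1 :: encodeNat w.2)
            (l.map fun p => (p.1, address v p.2)) := by
      intro l
      induction l with
      | nil => rfl
      | cons p l ih =>
        simp only [List.foldr_cons, Gen.eval, ih, eval_literalGen]
        simp [encodeList]
    simp [gen, Gen.eval, h, eval, Gate.encode]
  | block x r l =>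
    intro v w
    simp [gen, Gen.eval, eval_literalGen, eval, Gate.encode, encodeList, List.flatMap_map]
  | app c d hc hd =>
    intro v w
    simp [gen, Gen.eval, hc, hd, eval]
  | loop x r c hc =>
    intro v w
    simp [gen, Gen.eval, hc, eval, List.flatMap_assoc]

/-- The output gate has one input per clause, so the circuit expression needs this number as a loop
bound. -/
theorem length_eval_count (c : Cls) : ∀ (v : Var → ℕ) (w : List Bool),
    (c.count.eval v w).length = (c.eval v).length := by
  induction c with
  | clause l => intro v w; rfl
  | block x r l => intro v w; rfl
  | app c d hc hd =>
    intro v w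
    simp [count, Gen.eval, hc, hd, eval]
  | loop x r c hc =>
    intro v w
    simp [count, Gen.eval, hc, eval, List.length_flatMap]

/-- The encoding of the circuit for the formula over as many variables as the number `3` tells.
The number `2` has to be the length of the data word. -/
def circuitGen (c : Cls) : Gen :=
  .app (.ones 3) <| .app (.lit [false]) <| .app .bits <| .app c.gen <| .letLen 14 c.count <|
  .app (.lit [true, true]) <|
  .app (.loop 13 14 (.app (.lit [true, false])
    (.app (.ones 3) (.app (.ones 2) (.app (.ones 13) (.lit [false])))))) (.lit [false, false])

/-- The three symbols that `bits` writes for a bit are precisely the list entry of a gate without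
inputs of that type. The closing pair of `false`s ends the inputs of the output gate and the list of
gates. -/
theorem eval_circuitGen (c : Cls) (v : Var → ℕ) (w : List Bool) (hw : v 2 = w.length) :
    c.circuitGen.eval v w = encodeGates (v 3) (cnfGates (v 3) w (c.eval v)) := by
  have h : ∀ (a b c : ℕ) (l : List Bool), List.replicate a true ++ (List.replicate b true ++
      (List.replicate c true ++ l)) = List.replicate (a + (b + c)) true ++ l := by
    intro a b c l
    rw [List.replicate_add, List.replicate_add, List.append_assoc, List.append_assoc]
  simp [circuitGen, Gen.eval, eval_gen, length_eval_count, encodeGates, cnfGates, encodeNat,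
    encodeList, Gate.encode, List.flatMap_map, hw, h]

end Cls

/-! ### Truth of clause families -/

section Sat

variable {τ : ℕ → Bool} {v : Var → ℕ}

theorem sat_app {c d : Cls} : Sat τ ((Cls.app c d).eval v) ↔ Sat τ (c.eval v) ∧ Sat τ (d.eval v) := by
  simp [Sat, Cls.eval, or_imp, forall_and]

theorem sat_loop {x r : Var} {c : Cls} :
    Sat τ ((Cls.loop x r c).eval v) ↔ ∀ i < v r, Sat τ (c.eval (Function.update v x i)) := by
  simp only [Sat, Cls.eval, List.mem_flatMap, List.mem_range]
  exact ⟨fun h i hi l hl => h l ⟨i, hi, hl⟩, fun h l ⟨i, hi, hl⟩ => h i hi l hl⟩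

theorem sat_clause {l : List (Bool × List Atom)} :
    Sat τ ((Cls.clause l).eval v) ↔ ∃ p ∈ l, xor p.1 (τ (address v p.2)) = true := by
  simp [Sat, Cls.eval]

theorem sat_block {x r : Var} {l : List Atom} :
    Sat τ ((Cls.block x r l).eval v) ↔
      ∃ i < v r, τ (address (Function.update v x i) l) = true := by
  simp [Sat, Cls.eval]

end Sat

end GrundyW

namespace GrundyW

/-! ### Footprint sequences in conjunctive normal form -/

/-- There are `k` rows `ρ i` with property `P` and `k` columns `γ i` such that the row `ρ i`
footprints the column `γ i`. -/
def HasSeq (k R C : ℕ) (N₁ N₂ : ℕ → ℕ → Prop) (P : ℕ → Prop) : Prop :=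
  ∃ ρ γ : ℕ → ℕ, ∀ i < k, ρ i < R ∧ γ i < C ∧ P (ρ i) ∧ N₁ (ρ i) (γ i) ∧
    ∀ j < i, ¬ N₂ (ρ j) (γ i) ∧ ρ j ≠ ρ i

/-- The relations `x i r` and `y i c` select rows and columns that witness `HasSeq`. -/
structure Selects (k R C : ℕ) (N₁ N₂ : ℕ → ℕ → Prop) (P : ℕ → Prop) (x y : ℕ → ℕ → Prop) :
    Prop where
  row : ∀ i < k, ∃ r < R, x i r
  col : ∀ i < k, ∃ c < C, y i c
  pos : ∀ i < k, ∀ r < R, ∀ c < C, x i r → y i c → N₁ r c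
  neg : ∀ i < k, ∀ j < i, ∀ r < R, ∀ c < C, x j r → y i c → ¬ N₂ r c
  inj : ∀ i < k, ∀ j < i, ∀ r < R, x j r → ¬ x i r
  prop : ∀ i < k, ∀ r < R, x i r → P r

/-- The fields `pos`, `neg`, `inj` and `prop` range over all selected rows and columns, so any
choice from `row` and `col` works. Uniqueness of the selection, and thus the weight, plays no role
here. -/
theorem Selects.hasSeq {k R C : ℕ} {N₁ N₂ : ℕ → ℕ → Prop} {P : ℕ → Prop} {x y : ℕ → ℕ → Prop}
    (h : Selects k R C N₁ N₂ P x y) : HasSeq k R C N₁ N₂ P := by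
  choose! ρ hρ hx using h.row
  choose! γ hγ hy using h.col
  refine ⟨ρ, γ, fun i hi => ⟨hρ i hi, hγ i hi, h.prop i hi _ (hρ i hi) (hx i hi),
    h.pos i hi _ (hρ i hi) _ (hγ i hi) (hx i hi) (hy i hi), fun j hj => ?_⟩⟩
  have hjk := hj.trans hi
  refine ⟨h.neg i hi j hj _ (hρ j hjk) _ (hγ i hi) (hx j hjk) (hy i hi), fun he => ?_⟩
  exact h.inj i hi j hj _ (hρ j hjk) (hx j hjk) (he ▸ hx i hi)

/-- Row and column blocks have the common width `B`, and the `2k` blocks lie one behind the other. A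
sequence gives the assignment with one true variable per block; the converse is `Selects.hasSeq`. -/
theorem hasSeq_iff {k B R C : ℕ} (hR : R ≤ B) (hC : C ≤ B) {N₁ N₂ : ℕ → ℕ → Prop}
    {P : ℕ → Prop} : HasSeq k R C N₁ N₂ P ↔
    ∃ a : ℕ → Bool, ((Finset.range (k * B + k * B)).filter fun i => a i = true).card = 2 * k ∧
      Selects k R C N₁ N₂ P (fun i r => a (i * B + r) = true)
        (fun i c => a (k * B + (i * B + c)) = true) := by
  constructor
  · rintro ⟨ρ, γ, h⟩
    -- The position selected in block `t`: the first `k` blocks are for rows, the others for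
    -- columns.
    let s : ℕ → ℕ := fun t => if t < k then ρ t else γ (t - k)
    have hs : ∀ t < 2 * k, s t < B := by
      intro t ht
      simp only [s]
      split_ifs with htk
      · exact (h t htk).1.trans_le hR
      · exact (h (t - k) (by omega)).2.1.trans_le hC
    -- Block and position are quotient and remainder modulo `B`.
    have hinj : ∀ t t' r r', r < B → r' < B → t * B + r = t' * B + r' → t = t' ∧ r = r' := by
      intro t t' r r' hr hr' he
      have h₁ := congrArg (· / B) he
      have h₂ := congrArg (· % B) he
      have hB : 0 < B := by omega
      simp only [Nat.mul_comm _ B, Nat.mul_add_div hB, Nat.div_eq_of_lt hr, Nat.div_eq_of_lt hr',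
        Nat.mul_add_mod, Nat.mod_eq_of_lt hr, Nat.mod_eq_of_lt hr'] at h₁ h₂
      omega
    let T : Finset ℕ := (Finset.range (2 * k)).image fun t => t * B + s t
    have hT : T.card = 2 * k := by
      rw [Finset.card_image_of_injOn, Finset.card_range]
      intro t ht t' ht' he
      simp only [Finset.coe_range, Set.mem_Iio] at ht ht'
      exact (hinj _ _ _ _ (hs t ht) (hs t' ht') he).1
    have hmem : ∀ i < 2 * k, ∀ r < B, i * B + r ∈ T ↔ s i = r := by
      intro i hi r hr
      simp only [T, Finset.mem_image, Finset.mem_range]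
      constructor
      · rintro ⟨t, ht, he⟩
        obtain ⟨rfl, rfl⟩ := hinj _ _ _ _ (hs t ht) hr he
        rfl
      · rintro rfl
        exact ⟨i, hi, rfl⟩
    have hx : ∀ i < k, ∀ r < R, i * B + r ∈ T ↔ ρ i = r := by
      intro i hi r hr
      rw [hmem i (by omega) r (by omega)]
      simp only [s, if_pos hi]
    have hy : ∀ i < k, ∀ c < C, k * B + (i * B + c) ∈ T ↔ γ i = c := by
      intro i hi c hc
      rw [← add_assoc, ← add_mul, hmem (k + i) (by omega) c (by omega)]
      simp only [s, if_neg (by omega : ¬ k + i < k), Nat.add_sub_cancel_left]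
    refine ⟨fun i => decide (i ∈ T), ?_, ?_, ?_, ?_, ?_, ?_, ?_⟩
    · rw [← hT]
      congr 1
      ext m
      simp only [decide_eq_true_eq, Finset.mem_filter, Finset.mem_range, and_iff_right_iff_imp]
      intro hm
      obtain ⟨t, ht, rfl⟩ := Finset.mem_image.1 hm
      have ht := Finset.mem_range.1 ht
      calc t * B + s t < t * B + B := Nat.add_lt_add_left (hs t ht) _
        _ = (t + 1) * B := (Nat.succ_mul t B).symm
        _ ≤ (2 * k) * B := Nat.mul_le_mul_right _ ht
        _ = k * B + k * B := by ring
    all_goals simp only [decide_eq_true_eq]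
    · exact fun i hi => ⟨ρ i, (h i hi).1, (hx i hi _ (h i hi).1).2 rfl⟩
    · exact fun i hi => ⟨γ i, (h i hi).2.1, (hy i hi _ (h i hi).2.1).2 rfl⟩
    · intro i hi r hr c hc h₁ h₂
      rw [hx i hi r hr] at h₁
      rw [hy i hi c hc] at h₂
      exact h₁ ▸ h₂ ▸ (h i hi).2.2.2.1
    · intro i hi j hj r hr c hc h₁ h₂
      rw [hx j (hj.trans hi) r hr] at h₁
      rw [hy i hi c hc] at h₂
      exact h₁ ▸ h₂ ▸ ((h i hi).2.2.2.2 j hj).1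
    · intro i hi j hj r hr h₁ h₂
      rw [hx j (hj.trans hi) r hr] at h₁
      rw [hx i hi r hr] at h₂
      exact ((h i hi).2.2.2.2 j hj).2 (h₁.trans h₂.symm)
    · intro i hi r hr h₁
      rw [hx i hi r hr] at h₁
      exact h₁ ▸ (h i hi).2.2.1
  · rintro ⟨a, -, h⟩
    exact h.hasSeq

/-- All nodes in the clauses `L` are smaller than `N`. -/
def Bdd (N : ℕ) (L : List (List (Bool × ℕ))) : Prop := ∀ l ∈ L, ∀ x ∈ l, x.2 < N

section Bdd

variable {N : ℕ} {v : Var → ℕ}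

theorem bdd_app {c d : Cls} : Bdd N ((Cls.app c d).eval v) ↔ Bdd N (c.eval v) ∧ Bdd N (d.eval v) := by
  simp only [Bdd, Cls.eval, List.mem_append, or_imp, forall_and]

theorem bdd_loop {x r : Var} {c : Cls} :
    Bdd N ((Cls.loop x r c).eval v) ↔ ∀ i < v r, Bdd N (c.eval (Function.update v x i)) := by
  simp only [Bdd, Cls.eval, List.mem_flatMap, List.mem_range]
  exact ⟨fun h i hi l hl => h l ⟨i, hi, hl⟩, fun h l ⟨i, hi, hl⟩ => h i hi l hl⟩

theorem bdd_clause {l : List (Bool × List Atom)} :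
    Bdd N ((Cls.clause l).eval v) ↔ ∀ p ∈ l, address v p.2 < N := by
  simp only [Bdd, Cls.eval, List.mem_singleton, forall_eq, List.mem_map]
  exact ⟨fun h p hp => h _ ⟨p, hp, rfl⟩, fun h x ⟨p, hp, hx⟩ => hx ▸ h p hp⟩

theorem bdd_block {x r : Var} {l : List Atom} :
    Bdd N ((Cls.block x r l).eval v) ↔ ∀ i < v r, address (Function.update v x i) l < N := by
  simp only [Bdd, Cls.eval, List.mem_singleton, forall_eq, List.mem_map, List.mem_range]
  exact ⟨fun h i hi => h _ ⟨i, hi, rfl⟩, fun h x ⟨i, hi, hx⟩ => hx ▸ h i hi⟩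

end Bdd

/-- The variable that says that the row `r` is the `i`-th one. -/
def rowNode (i r : Var) : List Atom := [.mul i 4, .var r]

/-- The variable that says that the column `c` is the `i`-th one. -/
def colNode (i c : Var) : List Atom := [.mul 0 4, .mul i 4, .var c]

/-- The entry in row `r` and column `c` of the matrix that starts at position `o` of the data
word. -/
def entryNode (o : ℕ) (r c : Var) : List Atom := [.var 3, .const o, .mul r 7, .var c]

/-- The formula for `HasSeq`. Besides the parameter, it depends on the number `3` of variables, the
number `4` of variables in a block, the number `5` of rows, the number `6` of columns, and the
distance `7` between consecutive rows in the data word. -/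
def seqCls (b₁ b₂ : Bool) (o : ℕ) : Cls :=
  .app (.loop 8 0 (.block 12 5 (rowNode 8 12))) <|
  .app (.loop 8 0 (.block 12 6 (colNode 8 12))) <|
  .app (.loop 8 0 (.loop 10 5 (
    if b₁ then
      .loop 11 10 (.app
        (.clause [(true, rowNode 8 10), (true, colNode 8 11), (false, entryNode o 10 11)])
        (.clause [(true, rowNode 8 11), (true, colNode 8 10), (false, entryNode o 11 10)]))
    else
      .loop 11 6
        (.clause [(true, rowNode 8 10), (true, colNode 8 11), (false, entryNode o 10 11)])))) <|
  .app (.loop 8 0 (.loop 9 8 (.loop 10 5 (.loop 11 6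
    (.clause [(true, rowNode 9 10), (true, colNode 8 11), (true, entryNode o 10 11)]))))) <|
  .app (.loop 8 0 (.loop 9 8 (.loop 10 5
    (.clause [(true, rowNode 9 10), (true, if b₂ then colNode 8 10 else rowNode 8 10)]))))
  (.loop 8 0 (.loop 9 8 (.loop 10 5 (.clause [(true, rowNode 9 10), (true, rowNode 8 10)]))))

theorem sat_clause_three {τ : ℕ → Bool} {v : Var → ℕ} {l₁ l₂ l₃ : List Atom} {b : Bool} :
    Sat τ ((Cls.clause [(true, l₁), (true, l₂), (b, l₃)]).eval v) ↔
      (τ (address v l₁) = true → τ (address v l₂) = true → τ (address v l₃) = !b) := by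
  rw [sat_clause]
  cases b <;> cases h₁ : τ (address v l₁) <;> cases h₂ : τ (address v l₂) <;>
    cases h₃ : τ (address v l₃) <;> simp [h₁, h₂, h₃]

theorem sat_clause_or {τ : ℕ → Bool} {v : Var → ℕ} {l₁ l₂ l₃ : List Atom} :
    Sat τ ((Cls.clause [(true, l₁), (false, l₂), (false, l₃)]).eval v) ↔
      (τ (address v l₁) = true → τ (address v l₂) = true ∨ τ (address v l₃) = true) := by
  rw [sat_clause]
  cases h₁ : τ (address v l₁) <;> simp [h₁]

theorem sat_clause_one {τ : ℕ → Bool} {v : Var → ℕ} {l : List Atom} {b : Bool} :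
    Sat τ ((Cls.clause [(b, l)]).eval v) ↔ τ (address v l) = !b := by
  rw [sat_clause]
  cases b <;> cases h : τ (address v l) <;> simp [h]

theorem sat_clause_two {τ : ℕ → Bool} {v : Var → ℕ} {l₁ l₂ : List Atom} {b : Bool} :
    Sat τ ((Cls.clause [(true, l₁), (b, l₂)]).eval v) ↔
      (τ (address v l₁) = true → τ (address v l₂) = !b) := by
  rw [sat_clause]
  cases b <;> cases h₁ : τ (address v l₁) <;> cases h₂ : τ (address v l₂) <;> simp [h₁, h₂]

/-- For `b₁` the diagonal has to be exempt from the positive condition. The clauses then run over `c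
< r` and treat both orders of the pair, which covers exactly `r ≠ c`. For `b₂` the diagonal has to
be forbidden as well, which is the extra clause against selecting `r` as an earlier row and as a
later column. Without `b₂` its slot repeats the injectivity clause. Both variants identify rows with
columns and need `R = C`. -/
theorem sat_seqCls {τ : ℕ → Bool} {v : Var → ℕ} {b₁ b₂ : Bool} {o k B R C S V : ℕ}
    (h0 : v 0 = k) (h3 : v 3 = V) (h4 : v 4 = B) (h5 : v 5 = R) (h6 : v 6 = C) (h7 : v 7 = S)
    (hb₁ : b₁ = true → R = C) (hb₂ : b₂ = true → R = C) :
    Sat τ ((seqCls b₁ b₂ o).eval v) ↔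
      Selects k R C (fun r c => (b₁ = true ∧ r = c) ∨ τ (V + (o + (r * S + c))) = true)
        (fun r c => (b₂ = true ∧ r = c) ∨ τ (V + (o + (r * S + c))) = true) (fun _ => True)
        (fun i r => τ (i * B + r) = true) (fun i c => τ (k * B + (i * B + c)) = true) := by
  cases b₁ <;> cases b₂ <;>
  simp only [seqCls, sat_app, sat_loop, sat_block, sat_clause_three, sat_clause_two, address,
    rowNode, colNode, entryNode, Atom.eval, if_true, if_false, Bool.false_eq_true, List.map_cons,
    List.map_nil, List.sum_cons, List.sum_nil, add_zero, false_and, true_and, false_or] <;>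
  simp [h0, h3, h4, h5, h6, h7]
  · constructor
    · rintro ⟨h₁, h₂, h₃, h₄, h₅⟩
      exact ⟨h₁, h₂, h₃, by simpa using h₄, by simpa using h₅, by simp⟩
    · rintro ⟨h₁, h₂, h₃, h₄, h₅, -⟩
      simp only [Bool.not_eq_true] at h₄ h₅
      exact ⟨h₁, h₂, h₃, h₄, h₅⟩
  · obtain rfl := hb₂ rfl
    constructor
    · rintro ⟨h₁, h₂, h₃, h₄, h₅, h₆⟩
      refine ⟨h₁, h₂, h₃, ?_, by simpa using h₆, by simp⟩
      rintro i hi j hj r hr c hc hx hy (rfl | hE)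
      · simp [h₅ i hi j hj r hr hx] at hy
      · simp [h₄ i hi j hj r hr c hc hx hy] at hE
    · rintro ⟨h₁, h₂, h₃, h₄, h₅, -⟩
      simp only [not_or, Bool.not_eq_true] at h₄ h₅
      refine ⟨h₁, h₂, h₃, fun i hi j hj r hr c hc hx hy => (h₄ i hi j hj r hr c hc hx hy).2,
        fun i hi j hj r hr hx => ?_, h₅⟩
      by_contra hy
      exact (h₄ i hi j hj r hr r hr hx (by simpa using hy)).1 rfl
  · obtain rfl := hb₁ rfl
    constructor
    · rintro ⟨h₁, h₂, h₃, h₄, h₅⟩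
      refine ⟨h₁, h₂, fun i hi r hr c hc hx hy => ?_, by simpa using h₄, by simpa using h₅,
        by simp⟩
      rcases lt_trichotomy r c with h | h | h
      · exact Or.inr ((h₃ i hi c hc r h).2 hx hy)
      · exact Or.inl h
      · exact Or.inr ((h₃ i hi r hr c h).1 hx hy)
    · rintro ⟨h₁, h₂, h₃, h₄, h₅, -⟩
      simp only [Bool.not_eq_true] at h₄ h₅
      exact ⟨h₁, h₂, fun i hi r hr c hc =>
        ⟨fun hx hy => (h₃ i hi r hr c (hc.trans hr) hx hy).resolve_left hc.ne',
          fun hx hy => (h₃ i hi c (hc.trans hr) r hr hx hy).resolve_left hc.ne⟩, h₄, h₅⟩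
  · obtain rfl := hb₁ rfl
    constructor
    · rintro ⟨h₁, h₂, h₃, h₄, h₅, h₆⟩
      refine ⟨h₁, h₂, fun i hi r hr c hc hx hy => ?_, ?_, by simpa using h₆, by simp⟩
      · rcases lt_trichotomy r c with h | h | h
        · exact Or.inr ((h₃ i hi c hc r h).2 hx hy)
        · exact Or.inl h
        · exact Or.inr ((h₃ i hi r hr c h).1 hx hy)
      · rintro i hi j hj r hr c hc hx hy (rfl | hE)
        · simp [h₅ i hi j hj r hr hx] at hy
        · simp [h₄ i hi j hj r hr c hc hx hy] at hE
    · rintro ⟨h₁, h₂, h₃, h₄, h₅, -⟩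
      simp only [not_or, Bool.not_eq_true] at h₄ h₅
      refine ⟨h₁, h₂, fun i hi r hr c hc =>
        ⟨fun hx hy => (h₃ i hi r hr c (hc.trans hr) hx hy).resolve_left hc.ne',
          fun hx hy => (h₃ i hi c (hc.trans hr) r hr hx hy).resolve_left hc.ne⟩,
        fun i hi j hj r hr c hc hx hy => (h₄ i hi j hj r hr c hc hx hy).2,
        fun i hi j hj r hr hx => ?_, h₅⟩
      by_contra hy
      exact (h₄ i hi j hj r hr r hr hx (by simpa using hy)).1 rfl

theorem mul_add_lt {i k r B : ℕ} (hi : i < k) (hr : r < B) : i * B + r < k * B := by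
  calc i * B + r < i * B + B := Nat.add_lt_add_left hr _
    _ = (i + 1) * B := (Nat.succ_mul i B).symm
    _ ≤ k * B := Nat.mul_le_mul_right _ hi

/-- Clauses may refer to variables and constants only; this is what makes the circuit acyclic and
layered. -/
theorem bdd_seqCls {v : Var → ℕ} {b₁ b₂ : Bool} {o k B R C S V M : ℕ}
    (h0 : v 0 = k) (h3 : v 3 = V) (h4 : v 4 = B) (h5 : v 5 = R) (h6 : v 6 = C) (h7 : v 7 = S)
    (hV : k * B + k * B ≤ V) (hR : R ≤ B) (hC : C ≤ B)
    (hb₁ : b₁ = true → R = C) (hb₂ : b₂ = true → R = C)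
    (hM : ∀ r < R, ∀ c < C, o + (r * S + c) < M) :
    Bdd (V + M) ((seqCls b₁ b₂ o).eval v) := by
  have hrow : ∀ i < k, ∀ r < B, i * B + r < V + M := fun i hi r hr => by
    have := mul_add_lt hi hr
    omega
  have hcol : ∀ i < k, ∀ c < B, k * B + (i * B + c) < V + M := fun i hi c hc => by
    have := mul_add_lt hi hc
    omega
  cases b₁ <;> cases b₂ <;> (try obtain rfl := hb₁ rfl) <;>
  simp only [seqCls, bdd_app, bdd_loop, bdd_block, bdd_clause, address, rowNode, colNode, entryNode,
    Atom.eval, if_true, if_false, Bool.false_eq_true, List.map_cons,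
    List.map_nil, List.sum_cons, List.sum_nil, add_zero, List.mem_cons, List.not_mem_nil, or_false,
    forall_eq_or_imp, forall_eq] <;>
  simp [h0, h3, h4, h5, h6, h7] <;>
  (repeat' first | apply And.intro | intro _) <;>
  first
  | exact hrow _ (by omega) _ (by omega)
  | exact hcol _ (by omega) _ (by omega)
  | exact hM _ (by omega) _ (by omega)

end GrundyW

/-! ### Circuits that extend the footprint formula -/

namespace GrundyW

theorem Selects.congr {k R C : ℕ} {N₁ N₂ : ℕ → ℕ → Prop} {P : ℕ → Prop} {x y x' y' : ℕ → ℕ → Prop}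
    (h : Selects k R C N₁ N₂ P x y) (hx : ∀ i < k, ∀ r < R, x' i r ↔ x i r)
    (hy : ∀ i < k, ∀ c < C, y' i c ↔ y i c) : Selects k R C N₁ N₂ P x' y' where
  row i hi := let ⟨r, hr, h⟩ := h.row i hi; ⟨r, hr, (hx i hi r hr).2 h⟩
  col i hi := let ⟨c, hc, h⟩ := h.col i hi; ⟨c, hc, (hy i hi c hc).2 h⟩
  pos i hi r hr c hc h₁ h₂ := h.pos i hi r hr c hc ((hx i hi r hr).1 h₁) ((hy i hi c hc).1 h₂)
  neg i hi j hj r hr c hc h₁ h₂ :=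
    h.neg i hi j hj r hr c hc ((hx j (hj.trans hi) r hr).1 h₁) ((hy i hi c hc).1 h₂)
  inj i hi j hj r hr h₁ h₂ :=
    h.inj i hi j hj r hr ((hx j (hj.trans hi) r hr).1 h₁) ((hx i hi r hr).1 h₂)
  prop i hi r hr h₁ := h.prop i hi r hr ((hx i hi r hr).1 h₁)

theorem nodeValue_add (V : ℕ) (w : List Bool) (a : ℕ → Bool) (j : ℕ) :
    nodeValue V w a (V + j) = w.getD j false := by
  rw [nodeValue, if_neg (by omega), Nat.add_sub_cancel_left]

theorem nodeValue_of_lt {V : ℕ} (w : List Bool) (a : ℕ → Bool) {j : ℕ} (hj : j < V) :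
    nodeValue V w a j = a j := if_pos hj

/-- The circuit of a formula that extends the one for `HasSeq`. -/
theorem mem_WCS_seqCls {c : Cls} {v : Var → ℕ} {w : List Bool} {b₁ b₂ : Bool}
    {o k B R C S : ℕ} {P : ℕ → Prop} {Q : Prop}
    (h0 : v 0 = k) (h3 : v 3 = k * B + k * B) (h4 : v 4 = B) (h5 : v 5 = R) (h6 : v 6 = C)
    (h7 : v 7 = S) (hR : R ≤ B) (hC : C ≤ B) (hb₁ : b₁ = true → R = C) (hb₂ : b₂ = true → R = C)
    (hw : ∀ r < R, ∀ c < C, o + (r * S + c) < w.length)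
    (hc : Bdd (v 3 + w.length) (c.eval v))
    (hQ : ∀ a, Sat (nodeValue (v 3) w a) (c.eval v) ↔
      (∀ i < k, ∀ r < R, a (i * B + r) = true → P r) ∧ Q) :
    (encodeGates (v 3) (cnfGates (v 3) w ((Cls.app (seqCls b₁ b₂ o) c).eval v)), 2 * k) ∈
      WCS 3 3 ↔
    HasSeq k R C (fun r c => (b₁ = true ∧ r = c) ∨ w.getD (o + (r * S + c)) false = true)
        (fun r c => (b₂ = true ∧ r = c) ∨ w.getD (o + (r * S + c)) false = true) P ∧ Q := by
  rw [mem_WCS_cnfGates (bdd_app.2 ⟨bdd_seqCls h0 rfl h4 h5 h6 h7 h3.ge hR hC hb₁ hb₂ hw, hc⟩)]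
  simp only [sat_app, sat_seqCls h0 rfl h4 h5 h6 h7 hb₁ hb₂, nodeValue_add, hQ]
  have hx : ∀ a, ∀ i < k, ∀ r < R, nodeValue (v 3) w a (i * B + r) = true ↔
      a (i * B + r) = true := by
    intro a i hi r hr
    have := mul_add_lt hi (hr.trans_le hR)
    rw [nodeValue_of_lt w a (by omega)]
  have hy : ∀ a, ∀ i < k, ∀ c < C, nodeValue (v 3) w a (k * B + (i * B + c)) = true ↔
      a (k * B + (i * B + c)) = true := by
    intro a i hi c hc
    have := mul_add_lt hi (hc.trans_le hC)
    rw [nodeValue_of_lt w a (by omega)]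
  constructor
  · rintro ⟨a, -, hs, hP, hQ⟩
    have hs' := hs.congr (fun i hi r hr => (hx a i hi r hr).symm)
      (fun i hi c hc => (hy a i hi c hc).symm)
    -- The base formula has the trivial row property; `P` comes from the additional clauses.
    exact ⟨Selects.hasSeq ⟨hs'.row, hs'.col, hs'.pos, hs'.neg, hs'.inj, hP⟩, hQ⟩
  · rintro ⟨hs, hQ⟩
    obtain ⟨a, ha, hs⟩ := (hasSeq_iff hR hC).1 hs
    have hs' := hs.congr (hx a) (hy a)
    exact ⟨a, by rw [h3]; exact ha, ⟨hs'.row, hs'.col, hs'.pos, hs'.neg, hs'.inj, by simp⟩,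
      hs.prop, hQ⟩

/-! ### The circuits for graphs -/

/-- The position of the data word that says whether the vertex `r` is in the distinguished set. -/
def sideNode (r : Var) : List Atom := [.var 3, .const 1, .mul 1 1, .var r]

/-- The adjacency matrix is irreflexive and symmetric. -/
def validCls : Cls :=
  .app (.loop 10 1 (.clause [(true, entryNode 1 10 10)]))
    (.loop 10 1 (.loop 11 1 (.clause [(true, entryNode 1 10 11), (false, entryNode 1 11 10)])))

/-- All rows are in the distinguished set, and each edge has exactly one end there. -/
def sidedCls : Cls :=
  .app (.loop 8 0 (.loop 10 1 (.clause [(true, rowNode 8 10), (false, sideNode 10)])))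
    (.loop 10 1 (.loop 11 1 (.app
      (.clause [(true, entryNode 1 10 11), (false, sideNode 10), (false, sideNode 11)])
      (.clause [(true, entryNode 1 10 11), (true, sideNode 10), (true, sideNode 11)]))))

/-- The circuits for the problems on graphs. -/
def graphGen (b₁ b₂ s : Bool) : Gen :=
  .letLen 16 (addressGen ([.const 1, .mul 1 1] ++ if s then [.var 1] else [])) <| .ifEq 16 2 <|
  .letLen 3 (addressGen [.mul 0 1, .mul 0 1]) <| .letLen 4 (.ones 1) <| .letLen 5 (.ones 1) <|
  .letLen 6 (.ones 1) <| .letLen 7 (.ones 1) <|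
  (Cls.app (seqCls b₁ b₂ 1) (if s then .app sidedCls validCls else validCls)).circuitGen

theorem ok_graphGen (b₁ b₂ s : Bool) : (graphGen b₁ b₂ s).ok [0, 1, 2] [0, 1, 2] = true := by
  cases b₁ <;> cases b₂ <;> cases s <;> decide

/-- The entries of the adjacency matrix in a word. -/
def entry (x : List Bool) (r c : ℕ) : Prop :=
  (Gen.rest x).getD (1 + (r * Gen.head x + c)) false = true

/-- The distinguished set in a word. -/
def side (x : List Bool) (r : ℕ) : Prop :=
  (Gen.rest x).getD (1 + (Gen.head x * Gen.head x + r)) false = true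

/-- The right side says in terms of the word that it encodes an admissible input with a solution.
The length is compared by the machine itself, while symmetry, irreflexivity and bipartiteness are
clauses on constants, which no assignment can influence. -/
theorem graphGen_reduction (b₁ b₂ s : Bool) (p : List Bool × ℕ) :
    (graphGen b₁ b₂ s).reduction p ∈ WCS 3 3 ↔
    (Gen.rest p.1).length =
      1 + Gen.head p.1 * Gen.head p.1 + (if s then Gen.head p.1 else 0) ∧
    HasSeq p.2 (Gen.head p.1) (Gen.head p.1) (fun r c => (b₁ = true ∧ r = c) ∨ entry p.1 r c)
      (fun r c => (b₂ = true ∧ r = c) ∨ entry p.1 r c) (fun r => s = true → side p.1 r) ∧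
    (∀ r < Gen.head p.1, ¬ entry p.1 r r) ∧
    (∀ r < Gen.head p.1, ∀ c < Gen.head p.1, entry p.1 r c → entry p.1 c r) ∧
    (s = true → ∀ r < Gen.head p.1, ∀ c < Gen.head p.1, entry p.1 r c →
      (side p.1 r ↔ ¬ side p.1 c)) := by
  set n := Gen.head p.1 with hn
  set w := Gen.rest p.1 with hw
  by_cases hl : w.length = 1 + n * n + (if s then n else 0)
  swap
  · refine iff_of_false ?_ fun h => hl h.1
    -- A wrong length makes the guard `ifEq` produce the empty word.
    have h : (graphGen b₁ b₂ s).reduction p = ([], 2 * p.2) := by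
      refine Prod.ext ?_ rfl
      have : ¬ 1 + n * n + (if s then n else 0) = w.length := fun h => hl h.symm
      cases s <;>
      simp [Gen.reduction, graphGen, Gen.eval, eval_addressGen, address, Atom.eval, Gen.startEnv,
        ← hn, ← hw] <;> intro h <;> exact absurd h (by simpa [add_assoc] using this)
    rw [h]
    exact nil_notMem_WCS _ _ _
  obtain ⟨v, hv, h0, h1, h2, h3, h4, h5, h6, h7⟩ : ∃ v : Var → ℕ,
      (graphGen b₁ b₂ s).reduction p = ((Cls.app (seqCls b₁ b₂ 1)
        (if s then .app sidedCls validCls else validCls)).circuitGen.eval v w, 2 * p.2) ∧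
      v 0 = p.2 ∧ v 1 = n ∧ v 2 = w.length ∧ v 3 = p.2 * n + p.2 * n ∧ v 4 = n ∧ v 5 = n ∧
      v 6 = n ∧ v 7 = n := by
    cases s <;>
    refine ⟨Function.update (Function.update (Function.update (Function.update (Function.update
      (Function.update (Gen.startEnv p) 16 w.length) 3 (p.2 * n + p.2 * n)) 4 n) 5 n) 6 n) 7 n,
      ?_, ?_⟩
    · simp only [Bool.false_eq_true, if_false, add_zero] at hl
      simp [Gen.reduction, graphGen, Gen.eval, eval_addressGen, address, Atom.eval, Gen.startEnv,
        ← hn, ← hw, hl]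
    · simp [Gen.startEnv, ← hn, ← hw]
    · simp only [if_true, add_assoc] at hl
      simp [Gen.reduction, graphGen, Gen.eval, eval_addressGen, address, Atom.eval, Gen.startEnv,
        ← hn, ← hw, hl]
    · simp [Gen.startEnv, ← hn, ← hw]
  have hE : ∀ r < n, ∀ c < n, 1 + (r * n + c) < w.length := by
    intro r hr c hc
    have := mul_add_lt hr hc
    omega
  rw [hv, Cls.eval_circuitGen _ _ _ h2, mem_WCS_seqCls (P := fun r => s = true → side p.1 r) h0 h3
    h4 h5 h6 h7 le_rfl le_rfl (fun _ => rfl) (fun _ => rfl) hE (Q :=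
      (∀ r < n, ¬ entry p.1 r r) ∧ (∀ r < n, ∀ c < n, entry p.1 r c → entry p.1 c r) ∧
      (s = true → ∀ r < n, ∀ c < n, entry p.1 r c → (side p.1 r ↔ ¬ side p.1 c)))]
  · simp only [hl, true_and]
    rfl
  · have hrow : ∀ i < p.2, ∀ r < n, i * n + r < v 3 + w.length := fun i hi r hr => by
      have := mul_add_lt hi hr
      omega
    cases s <;>
    simp [validCls, sidedCls, bdd_app, bdd_loop, bdd_clause, address, rowNode, sideNode, entryNode,
      Atom.eval, h0, h1, h4, h7]
    · exact ⟨fun r hr => hE r hr r hr, fun r hr c hc => ⟨hE r hr c hc, hE c hc r hr⟩⟩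
    · have hS : ∀ r < n, 1 + (n * n + r) < w.length := by
        intro r hr
        simp only [if_true] at hl
        omega
      exact ⟨⟨fun i hi r hr => ⟨hrow i hi r hr, hS r hr⟩, fun r hr c hc =>
        ⟨hE r hr c hc, hS r hr, hS c hc⟩⟩,
        fun r hr => hE r hr r hr, fun r hr c hc => ⟨hE r hr c hc, hE c hc r hr⟩⟩
  · intro a
    have hrow : ∀ i < p.2, ∀ r < n, nodeValue (v 3) w a (i * n + r) = a (i * n + r) := by
      intro i hi r hr
      have := mul_add_lt hi hr
      exact nodeValue_of_lt w a (by omega)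
    have hvalid : Sat (nodeValue (v 3) w a) (validCls.eval v) ↔
        (∀ r < n, ¬ entry p.1 r r) ∧ (∀ r < n, ∀ c < n, entry p.1 r c → entry p.1 c r) := by
      simp [validCls, sat_app, sat_loop, sat_clause_two, sat_clause_one, address, entryNode, Atom.eval,
        h1, h7, nodeValue_add, entry, ← hn, ← hw]
    have hsided : Sat (nodeValue (v 3) w a) (sidedCls.eval v) ↔
        (∀ i < p.2, ∀ r < n, a (i * n + r) = true → side p.1 r) ∧
        ∀ r < n, ∀ c < n, entry p.1 r c → (side p.1 r ↔ ¬ side p.1 c) := by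
      simp [sidedCls, sat_app, sat_loop, sat_clause_two, sat_clause_three, sat_clause_or, address,
        entryNode, sideNode, rowNode, Atom.eval, h0, h1, h4, h7, nodeValue_add, entry, side,
        ← hn, ← hw]
      refine and_congr (forall₄_congr fun i hi r hr => by rw [hrow i hi r hr])
        (forall₄_congr fun r hr c hc => ?_)
      cases w[1 + (r * n + c)]?.getD false <;> cases w[1 + (n * n + r)]?.getD false <;>
        cases w[1 + (n * n + c)]?.getD false <;> simp
    cases s
    · simp [hvalid]
    · simp only [if_true, sat_app, hvalid, hsided, forall_const]
      tauto

end GrundyW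

namespace GrundyW

/-! ### Footprint sequences and words for graphs -/

/-- Whether a vertex footprints something depends only on its predecessors, so sequences can be
truncated. -/
theorem exists_footprintSeq_le_iff {V : Type*} {N₁ N₂ : V → Set V} {k : ℕ} :
    (∃ l, k ≤ l ∧ ∃ σ : Fin l → V, IsFootprintSeq N₁ N₂ σ) ↔
      ∃ σ : Fin k → V, IsFootprintSeq N₁ N₂ σ := by
  constructor
  · rintro ⟨l, hl, σ, hσ, h⟩
    refine ⟨fun i => σ (i.castLE hl), fun i j hij => Fin.castLE_injective hl (hσ hij), fun i => ?_⟩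
    obtain ⟨c, hc, hc'⟩ := h (i.castLE hl)
    simp only [Set.mem_iUnion, not_exists] at hc'
    refine ⟨c, hc, ?_⟩
    simp only [Set.mem_iUnion, not_exists]
    exact fun j hj => hc' (j.castLE hl) hj
  · rintro ⟨σ, h⟩
    exact ⟨k, le_rfl, σ, h⟩

theorem exists_footprintSeq_iff {n k : ℕ} {N₁ N₂ : Fin n → Set (Fin n)} {A : Set (Fin n)}
    {M₁ M₂ : ℕ → ℕ → Prop} {P : ℕ → Prop} (h₁ : ∀ r c : Fin n, c ∈ N₁ r ↔ M₁ r c)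
    (h₂ : ∀ r c : Fin n, c ∈ N₂ r ↔ M₂ r c) (hA : ∀ r : Fin n, r ∈ A ↔ P r) :
    (∃ σ : Fin k → Fin n, IsFootprintSeq N₁ N₂ σ ∧ ∀ i, σ i ∈ A) ↔ HasSeq k n n M₁ M₂ P := by
  constructor
  · rintro ⟨σ, ⟨hσ, h⟩, hσA⟩
    choose γ hγ hγ' using h
    simp only [Set.mem_iUnion, not_exists] at hγ'
    -- `HasSeq` never looks at indices from `k` on, so the default value is irrelevant.
    refine ⟨fun i => if hi : i < k then σ ⟨i, hi⟩ else 0,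
      fun i => if hi : i < k then γ ⟨i, hi⟩ else 0, fun i hi => ?_⟩
    simp only [dif_pos hi, Fin.is_lt, true_and]
    refine ⟨(hA _).1 (hσA _), (h₁ _ _).1 (hγ _), fun j hj => ?_⟩
    simp only [dif_pos (hj.trans hi)]
    refine ⟨fun h => hγ' ⟨i, hi⟩ ⟨j, hj.trans hi⟩ hj ((h₂ _ _).2 h), fun h => ?_⟩
    have := hσ (Fin.ext h)
    simp only [Fin.mk.injEq] at this
    omega
  · rintro ⟨ρ, γ, h⟩
    have hne : ∀ i < k, ∀ j < i, ρ j ≠ ρ i := fun i hi j hj => ((h i hi).2.2.2.2 j hj).2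
    refine ⟨fun i => ⟨ρ i, (h i i.2).1⟩, ⟨fun i j hij => ?_, fun i => ?_⟩,
      fun i => (hA _).2 (h i i.2).2.2.1⟩
    · simp only [Fin.mk.injEq] at hij
      rcases lt_trichotomy i j with hlt | rfl | hlt
      · exact absurd hij (hne j j.2 i hlt)
      · rfl
      · exact absurd hij.symm (hne i i.2 j hlt)
    · refine ⟨⟨γ i, (h i i.2).2.1⟩, (h₁ _ _).2 (h i i.2).2.2.2.1, ?_⟩
      simp only [Set.mem_iUnion, not_exists]
      exact fun j hj hmem => ((h i i.2).2.2.2.2 j hj).1 ((h₂ _ _).1 hmem)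

theorem head_encodeNat_append (n : ℕ) (u : List Bool) : Gen.head (encodeNat n ++ u) = n := by
  simp [Gen.head, encodeNat]

theorem rest_encodeNat_append (n : ℕ) (u : List Bool) :
    Gen.rest (encodeNat n ++ u) = false :: u := by
  simp [Gen.rest, encodeNat]

/-- A word that is not all `true` starts with a unary number whose terminator is the first symbol of
`rest`. -/
theorem eq_encodeNat_append {x : List Bool} (h : Gen.rest x ≠ []) :
    x = encodeNat (Gen.head x) ++ (Gen.rest x).tail := by
  have h₁ : x.takeWhile id = List.replicate (Gen.head x) true :=
    List.eq_replicate_iff.2 ⟨rfl, fun b hb => by simpa using List.mem_takeWhile_imp hb⟩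
  have h₂ : Gen.rest x = false :: (Gen.rest x).tail := by
    have h₃ : (Gen.rest x).head h = false := by
      simpa [Gen.rest] using List.head_dropWhile_not id h
    rw [← h₃, List.cons_head_tail]
  calc x = x.takeWhile id ++ x.dropWhile id := List.takeWhile_append_dropWhile.symm
    _ = List.replicate (Gen.head x) true ++ (false :: (Gen.rest x).tail) := by
      rw [h₁, ← h₂]
      rfl
    _ = _ := by simp [encodeNat]

theorem encodeSubset_eq_iff {n : ℕ} {S : Set (Fin n)} {u : List Bool} :
    u = encodeSubset S ↔ u.length = n ∧ ∀ i : Fin n, i ∈ S ↔ u.getD i false = true := by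
  constructor
  · rintro rfl
    refine ⟨by simp [encodeSubset], fun i => ?_⟩
    simp [encodeSubset]
  · rintro ⟨hu, h⟩
    refine List.ext_getElem (by simp [encodeSubset, hu]) fun i hi hi' => ?_
    have := h ⟨i, hu ▸ hi⟩
    rw [List.getD_eq_getElem _ _ hi] at this
    simp [encodeSubset, this]

/-- Induction on the number of rows: a word is a matrix written row by row as soon as its length
fits, and entry `(i, j)` stands at position `i * n + j`. -/
theorem flatten_ofFn_encodeSubset_eq_iff {m n : ℕ} {N : Fin m → Set (Fin n)} {u : List Bool} :
    u = (List.ofFn fun i => encodeSubset (N i)).flatten ↔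
      u.length = m * n ∧
        ∀ (i : Fin m) (j : Fin n), j ∈ N i ↔ u.getD (i * n + j) false = true := by
  induction m generalizing u with
  | zero => simp
  | succ m ih =>
    rw [List.ofFn_succ, List.flatten_cons]
    constructor
    · rintro rfl
      obtain ⟨h₁, h₂⟩ := (ih (N := fun i => N i.succ)).1 rfl
      obtain ⟨h₃, h₄⟩ := (encodeSubset_eq_iff (S := N 0)).1 rfl
      refine ⟨by rw [List.length_append, h₁, h₃]; ring, fun i j => ?_⟩
      refine Fin.cases ?_ (fun i => ?_) i
      · rw [h₄, List.getD_append _ _ _ _ (by simp [h₃])]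
        simp
      · rw [h₂, List.getD_append_right _ _ _ _ (by rw [h₃, Fin.val_succ, add_mul]; omega), h₃,
          Fin.val_succ, Nat.add_mul, one_mul]
        congr! 2
        omega
    · rintro ⟨hu, h⟩
      have h₁ : u.take n = encodeSubset (N 0) := by
        refine encodeSubset_eq_iff.2 ⟨by rw [List.length_take, hu, add_mul]; omega, fun j => ?_⟩
        rw [h 0 j]
        simp [List.getD_eq_getElem?_getD, j.2]
      have h₂ : u.drop n = (List.ofFn fun i => encodeSubset (N i.succ)).flatten := by
        refine (ih (N := fun i => N i.succ)).2
          ⟨by rw [List.length_drop, hu, add_mul]; omega, fun i j => ?_⟩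
        rw [h i.succ j]
        simp only [List.getD_eq_getElem?_getD, List.getElem?_drop, Fin.val_succ, add_mul, one_mul]
        rw [show (i : ℕ) * n + n + j = n + (i * n + j) by ring]
      rw [← h₁, ← h₂, List.take_append_drop]

/-- The open (`b = false`) or closed (`b = true`) neighborhood. -/
def nbhd (b : Bool) {V : Type*} (G : SimpleGraph V) : V → Set V :=
  if b then closedNbhd G else G.neighborSet

theorem mem_nbhd {b : Bool} {V : Type*} {G : SimpleGraph V} {r c : V} :
    c ∈ nbhd b G r ↔ (b = true ∧ r = c) ∨ G.Adj r c := by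
  cases b <;> simp [nbhd, closedNbhd, eq_comm]

/-- The offset 1 is the terminator of the number of vertices, which still belongs to `rest`. The
suffix `u` is empty for plain graphs and the characteristic vector of `A` in the one-sided problem.
-/
theorem eq_encodeGraph_append_iff {n : ℕ} {G : SimpleGraph (Fin n)} {u x : List Bool} :
    x = encodeGraph G ++ u ↔ Gen.head x = n ∧ (Gen.rest x).length = 1 + n * n + u.length ∧
      (∀ r c : Fin n, G.Adj r c ↔ entry x r c) ∧ u = (Gen.rest x).drop (1 + n * n) := by
  constructor
  · intro hx
    rw [encodeGraph, List.append_assoc] at hx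
    have hh : Gen.head x = n := by rw [hx, head_encodeNat_append]
    obtain ⟨hl, h⟩ := (flatten_ofFn_encodeSubset_eq_iff (N := fun i => G.neighborSet i)).1 rfl
    have hr := rest_encodeNat_append n
      ((List.ofFn fun i => encodeSubset (G.neighborSet i)).flatten ++ u)
    rw [← hx] at hr
    refine ⟨hh, by rw [hr, List.length_cons, List.length_append, hl]; ring, fun r c => ?_, ?_⟩
    · rw [← SimpleGraph.mem_neighborSet, h, entry, hr, hh, add_comm 1, List.getD_cons_succ,
        List.getD_append _ _ _ _ (by rw [hl]; exact mul_add_lt r.2 c.2)]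
    · rw [hr, add_comm 1, List.drop_succ_cons, List.drop_left' hl]
  · rintro ⟨hn, hl, h, hu⟩
    have hne : Gen.rest x ≠ [] := by
      intro h0
      rw [h0, List.length_nil] at hl
      omega
    have hx := eq_encodeNat_append hne
    rw [hn] at hx
    refine hx.trans ?_
    rw [encodeGraph, List.append_assoc, List.append_cancel_left_eq]
    obtain ⟨y, hy⟩ : ∃ y, Gen.rest x = false :: y := by
      refine ⟨(Gen.rest x).tail, ?_⟩
      conv_lhs => rw [hx]
      exact rest_encodeNat_append _ _
    have hrows : y.take (n * n) = (List.ofFn fun i => encodeSubset (G.neighborSet i)).flatten := by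
      refine flatten_ofFn_encodeSubset_eq_iff.2 ⟨?_, fun i j => ?_⟩
      · rw [hy, List.length_cons] at hl
        rw [List.length_take]
        omega
      · rw [SimpleGraph.mem_neighborSet, h, entry, hn, hy, add_comm 1, List.getD_cons_succ,
          List.getD_eq_getElem?_getD, List.getD_eq_getElem?_getD,
          List.getElem?_take_of_lt (mul_add_lt i.2 j.2)]
    rw [← hrows, hu, hy, add_comm 1, List.drop_succ_cons, List.tail_cons, List.take_append_drop]

/-- The graph that a word describes. -/
def wordGraph (x : List Bool) (h₁ : ∀ r < Gen.head x, ¬ entry x r r)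
    (h₂ : ∀ r < Gen.head x, ∀ c < Gen.head x, entry x r c → entry x c r) :
    SimpleGraph (Fin (Gen.head x)) where
  Adj r c := entry x r c
  symm := ⟨fun r c => h₂ r r.2 c c.2⟩
  loopless := ⟨fun r => h₁ r r.2⟩

/-! ### The problems on graphs -/

/-- The Boolean pair covers four problems: both neighborhoods closed for dominating sequences, both
open for total ones, only the second closed for `Z`-sequences and only the first for `L`-sequences.
If the circuit is satisfiable, its clauses on constants guarantee that the word describes a simple
graph. -/
theorem footprint_iff_reduction (b₁ b₂ : Bool) (p : List Bool × ℕ) :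
    (∃ (n : ℕ) (G : SimpleGraph (Fin n)), p.1 = encodeGraph G ∧
      ∃ l, p.2 ≤ l ∧ ∃ σ : Fin l → Fin n, IsFootprintSeq (nbhd b₁ G) (nbhd b₂ G) σ) ↔
    (graphGen b₁ b₂ false).reduction p ∈ WCS 3 3 := by
  rw [graphGen_reduction]
  simp only [Bool.false_eq_true, if_false, false_implies, add_zero, and_true]
  have hseq : ∀ (n : ℕ) (G : SimpleGraph (Fin n)), (∀ r c : Fin n, G.Adj r c ↔ entry p.1 r c) →
      ((∃ l, p.2 ≤ l ∧ ∃ σ : Fin l → Fin n, IsFootprintSeq (nbhd b₁ G) (nbhd b₂ G) σ) ↔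
        HasSeq p.2 n n (fun r c => (b₁ = true ∧ r = c) ∨ entry p.1 r c)
          (fun r c => (b₂ = true ∧ r = c) ∨ entry p.1 r c) fun _ => True) := by
    intro n G hG
    rw [exists_footprintSeq_le_iff, ← exists_footprintSeq_iff (N₁ := nbhd b₁ G) (N₂ := nbhd b₂ G)
      (A := Set.univ) (fun r c => by rw [mem_nbhd, hG, Fin.ext_iff])
      (fun r c => by rw [mem_nbhd, hG, Fin.ext_iff]) (by simp)]
    simp
  constructor
  · rintro ⟨n, G, hx, hσ⟩
    rw [← List.append_nil (encodeGraph G)] at hx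
    obtain ⟨rfl, hl, h, -⟩ := eq_encodeGraph_append_iff.1 hx
    exact ⟨hl, (hseq _ G h).1 hσ, fun r hr he => G.loopless.irrefl ⟨r, hr⟩ ((h _ _).2 he),
      fun r hr c hc he => (h ⟨c, hc⟩ ⟨r, hr⟩).1 ((h ⟨r, hr⟩ ⟨c, hc⟩).2 he).symm⟩
  · rintro ⟨hl, hσ, h₁, h₂⟩
    refine ⟨Gen.head p.1, wordGraph p.1 h₁ h₂, ?_, (hseq _ _ fun r c => Iff.rfl).2 hσ⟩
    rw [← List.append_nil (encodeGraph _)]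
    refine eq_encodeGraph_append_iff.2 ⟨rfl, hl, fun r c => Iff.rfl, ?_⟩
    rw [List.drop_of_length_le hl.le]

/-- The clauses on sides let each edge have exactly one end in `A`, which is bipartiteness with
respect to `A` and its complement. -/
theorem oneSided_iff_reduction (p : List Bool × ℕ) :
    p ∈ OneSidedGrundyTotalDomination ↔ (graphGen false false true).reduction p ∈ WCS 3 3 := by
  rw [graphGen_reduction]
  simp only [Bool.false_eq_true, if_true, false_and, false_or, forall_const]
  have hside : ∀ r, side p.1 r ↔
      ((Gen.rest p.1).drop (1 + Gen.head p.1 * Gen.head p.1)).getD r false = true := by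
    intro r
    rw [side, List.getD_eq_getElem?_getD, List.getD_eq_getElem?_getD, List.getElem?_drop,
      add_assoc]
  have hseq : ∀ (n : ℕ) (G : SimpleGraph (Fin n)) (A : Set (Fin n)),
      (∀ r c : Fin n, G.Adj r c ↔ entry p.1 r c) → (∀ r : Fin n, r ∈ A ↔ side p.1 r) →
      ((∃ σ : Fin p.2 → Fin n, IsTotalDominatingSeq G σ ∧ ∀ i, σ i ∈ A) ↔
        HasSeq p.2 n n (entry p.1) (entry p.1) (side p.1)) := by
    intro n G A hG hA
    exact exists_footprintSeq_iff (fun r c => hG r c) (fun r c => hG r c) hA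
  constructor
  · rintro ⟨n, G, A, hGA, hx, hσ⟩
    obtain ⟨rfl, hl, h, hu⟩ := eq_encodeGraph_append_iff.1 hx
    obtain ⟨hA, hA'⟩ := encodeSubset_eq_iff.1 hu.symm
    have hA'' : ∀ r : Fin (Gen.head p.1), r ∈ A ↔ side p.1 r := fun r => by rw [hA', hside]
    rw [← hu, encodeSubset, List.length_ofFn] at hA
    refine ⟨by simpa [encodeSubset] using hl, (hseq _ G A h hA'').1 hσ,
      fun r hr he => G.loopless.irrefl ⟨r, hr⟩ ((h _ _).2 he),
      fun r hr c hc he => (h ⟨c, hc⟩ ⟨r, hr⟩).1 ((h ⟨r, hr⟩ ⟨c, hc⟩).2 he).symm,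
      fun r hr c hc he => ?_⟩
    have := hGA.mem_of_adj ((h ⟨r, hr⟩ ⟨c, hc⟩).2 he)
    rw [← hA'' ⟨r, hr⟩, ← hA'' ⟨c, hc⟩]
    simp only [Set.mem_compl_iff] at this
    tauto
  · rintro ⟨hl, hσ, h₁, h₂, h₃⟩
    let A : Set (Fin (Gen.head p.1)) := {r | side p.1 r}
    refine ⟨Gen.head p.1, wordGraph p.1 h₁ h₂, A, ⟨disjoint_compl_right, fun r c he => ?_⟩, ?_,
      (hseq _ _ A (fun r c => Iff.rfl) fun r => Iff.rfl).2 hσ⟩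
    · have := h₃ r r.2 c c.2 he
      simp only [A, Set.mem_ofPred_eq, Set.mem_compl_iff]
      tauto
    · have hu : (Gen.rest p.1).drop (1 + Gen.head p.1 * Gen.head p.1) = encodeSubset A :=
        encodeSubset_eq_iff.2 ⟨by rw [List.length_drop, hl]; omega, fun r => hside r⟩
      exact eq_encodeGraph_append_iff.2 ⟨rfl, by rw [hl, encodeSubset, List.length_ofFn],
        fun r c => Iff.rfl, hu.symm⟩

theorem inW_grundyDomination : InW 3 GrundyDomination :=
  ⟨3, by norm_num, Gen.fptReducible (ok_graphGen true true false)
    fun p => footprint_iff_reduction true true p⟩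

theorem inW_totalGrundyDomination : InW 3 TotalGrundyDomination :=
  ⟨3, by norm_num, Gen.fptReducible (ok_graphGen false false false)
    fun p => footprint_iff_reduction false false p⟩

theorem inW_zGrundyDomination : InW 3 ZGrundyDomination :=
  ⟨3, by norm_num, Gen.fptReducible (ok_graphGen false true false)
    fun p => footprint_iff_reduction false true p⟩

theorem inW_lGrundyDomination : InW 3 LGrundyDomination :=
  ⟨3, by norm_num, Gen.fptReducible (ok_graphGen true false false)
    fun p => footprint_iff_reduction true false p⟩

theorem inW_oneSidedGrundyTotalDomination : InW 3 OneSidedGrundyTotalDomination :=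
  ⟨3, by norm_num, Gen.fptReducible (ok_graphGen false false true) oneSided_iff_reduction⟩

end GrundyW

namespace GrundyW

/-! ### Hypergraphs -/

/-- The matrix of a hypergraph has a marker for each edge, and one behind the last edge. -/
def markerCls : Cls :=
  .app (.loop 10 5 (.clause [(false, [.var 3, .const 1, .mul 10 7])]))
    (.clause [(true, [.var 3, .const 1, .mul 5 7])])

/-- The circuit for a hypergraph with as many edges as the number `17` tells. -/
def edgesGen : Gen :=
  .letLen 7 (addressGen [.const 1, .var 1]) <| .letLen 16 (addressGen [.const 2, .mul 17 7]) <|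
  .ifEq 16 2 <| .letLen 5 (.ones 17) <| .letLen 6 (.ones 1) <|
  .letLen 4 (addressGen [.var 17, .var 1]) <| .letLen 3 (addressGen [.mul 0 4, .mul 0 4]) <|
  (Cls.app (seqCls false false 2) markerCls).circuitGen

/-- The circuits for hypergraphs. -/
def hypergraphGen : Gen := .loop 17 2 edgesGen

theorem ok_hypergraphGen : hypergraphGen.ok [0, 1, 2] [0, 1, 2] = true := by decide

/-- The entries of the incidence matrix in a word. -/
def incidence (x : List Bool) (r c : ℕ) : Prop :=
  (Gen.rest x).getD (2 + (r * (Gen.head x + 1) + c)) false = true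

/-- The markers in front of the rows of the incidence matrix in a word. -/
def marker (x : List Bool) (r : ℕ) : Prop :=
  (Gen.rest x).getD (1 + r * (Gen.head x + 1)) false = true

theorem edgesGen_eval_of_ne {p : List Bool × ℕ} {m : ℕ}
    (hm : (Gen.rest p.1).length ≠ 2 + m * (Gen.head p.1 + 1)) :
    edgesGen.eval (Function.update (Gen.startEnv p) 17 m) (Gen.rest p.1) = [] := by
  have h : 2 + m * (1 + Gen.head p.1) ≠ (Gen.rest p.1).length := by
    rw [add_comm 1]
    exact hm.symm
  simp [edgesGen, Gen.eval, eval_addressGen, address, Atom.eval, Gen.startEnv, h]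

/-- The matrix has `m` rows and `n` columns, and `B = m + n` is a block width for both. Markers cost
one symbol per row, so rows are `n + 1` apart. -/
theorem edgesGen_mem_WCS {p : List Bool × ℕ} {m : ℕ}
    (hm : (Gen.rest p.1).length = 2 + m * (Gen.head p.1 + 1)) :
    (edgesGen.eval (Function.update (Gen.startEnv p) 17 m) (Gen.rest p.1), 2 * p.2) ∈ WCS 3 3 ↔
    HasSeq p.2 m (Gen.head p.1) (incidence p.1) (incidence p.1) (fun _ => True) ∧
      (∀ r < m, marker p.1 r) ∧ ¬ marker p.1 m := by
  set n := Gen.head p.1 with hn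
  set w := Gen.rest p.1 with hw
  obtain ⟨v, hv, h0, h2, h3, h4, h5, h6, h7⟩ : ∃ v : Var → ℕ,
      edgesGen.eval (Function.update (Gen.startEnv p) 17 m) w =
        (Cls.app (seqCls false false 2) markerCls).circuitGen.eval v w ∧
      v 0 = p.2 ∧ v 2 = w.length ∧ v 3 = p.2 * (m + n) + p.2 * (m + n) ∧ v 4 = m + n ∧ v 5 = m ∧
      v 6 = n ∧ v 7 = n + 1 := by
    refine ⟨Function.update (Function.update (Function.update (Function.update (Function.update
      (Function.update (Function.update (Gen.startEnv p) 17 m) 7 (n + 1)) 16 w.length) 5 m) 6 n) 4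
      (m + n)) 3 (p.2 * (m + n) + p.2 * (m + n)), ?_, ?_⟩
    · simp [edgesGen, Gen.eval, eval_addressGen, address, Atom.eval, Gen.startEnv, ← hn, ← hw, hm,
        add_comm 1 n]
    · simp [Gen.startEnv, ← hw]
  have hE : ∀ r < m, ∀ c < n + 1, r * (n + 1) + c < m * (n + 1) :=
    fun r hr c hc => mul_add_lt hr hc
  rw [hv, Cls.eval_circuitGen _ _ _ h2, mem_WCS_seqCls (P := fun _ => True) h0 h3
    h4 h5 h6 h7 (by omega) (by omega) (by simp) (by simp)
    (fun r hr c hc => by have := hE r hr c (by omega); omega)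
    (Q := (∀ r < m, marker p.1 r) ∧ ¬ marker p.1 m)]
  · simp only [Bool.false_eq_true, false_and, false_or]
    rfl
  · simp only [markerCls, bdd_app, bdd_loop, bdd_clause]
    simp [address, Atom.eval, h5, h7]
    refine ⟨fun r hr => ?_, by omega⟩
    have := hE r hr 0 (by omega)
    omega
  · intro a
    simp [markerCls, sat_app, sat_loop, sat_clause_one, address, Atom.eval, h5, h7, nodeValue_add,
      marker, ← hn, ← hw]

theorem flatMap_range_eq {α : Type*} {L m : ℕ} (hm : m < L) {f : ℕ → List α}
    (hf : ∀ i, i ≠ m → f i = []) : (List.range L).flatMap f = f m := by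
  induction L with
  | zero => omega
  | succ L ih =>
    rw [List.range_succ, List.flatMap_append, List.flatMap_singleton]
    rcases eq_or_ne m L with rfl | hne
    · rw [List.flatMap_eq_nil_iff.2 fun i hi => hf i (List.mem_range.1 hi).ne, List.nil_append]
    · rw [ih (by omega), hf L hne.symm, List.append_nil]

/-- The number of edges is not written in the word. The expression tries all candidates `m`, and
since the length determines `m`, at most one of them contributes output. -/
theorem hypergraphGen_reduction (p : List Bool × ℕ) :
    hypergraphGen.reduction p ∈ WCS 3 3 ↔
    ∃ m, (Gen.rest p.1).length = 2 + m * (Gen.head p.1 + 1) ∧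
      HasSeq p.2 m (Gen.head p.1) (incidence p.1) (incidence p.1) (fun _ => True) ∧
      (∀ r < m, marker p.1 r) ∧ ¬ marker p.1 m := by
  have hred : hypergraphGen.reduction p = ((List.range (Gen.rest p.1).length).flatMap fun m =>
      edgesGen.eval (Function.update (Gen.startEnv p) 17 m) (Gen.rest p.1), 2 * p.2) := rfl
  rw [hred]
  by_cases h : ∃ m, (Gen.rest p.1).length = 2 + m * (Gen.head p.1 + 1)
  · obtain ⟨m, hm⟩ := h
    have huniq : ∀ i, (Gen.rest p.1).length = 2 + i * (Gen.head p.1 + 1) → i = m := by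
      intro i hi
      exact Nat.eq_of_mul_eq_mul_right (Nat.succ_pos _) (by omega :
        i * (Gen.head p.1 + 1) = m * (Gen.head p.1 + 1))
    -- The right `m` is below the length of the rest, which is the loop bound.
    have hle : m ≤ m * (Gen.head p.1 + 1) := Nat.le_mul_of_pos_right _ (Nat.succ_pos _)
    rw [flatMap_range_eq (m := m) (by omega) fun i hi => edgesGen_eval_of_ne fun h =>
      hi (huniq i h), edgesGen_mem_WCS hm]
    constructor
    · exact fun h => ⟨m, hm, h⟩
    · rintro ⟨i, hi, h⟩
      exact huniq i hi ▸ h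
  · push Not at h
    refine iff_of_false ?_ fun ⟨m, hm, _⟩ => h m hm
    rw [List.flatMap_eq_nil_iff.2 fun m _ => edgesGen_eval_of_ne (h m)]
    exact nil_notMem_WCS _ _ _

/-- The list marker becomes the bit of a new vertex 0 that lies in all edges. Thus a list of edges
is a matrix with one more column, and the result on matrices applies. -/
theorem cons_encodeSubset {n : ℕ} (S : Set (Fin n)) :
    true :: encodeSubset S = encodeSubset (insert 0 (Fin.succ '' S)) := by
  rw [encodeSubset, encodeSubset, List.ofFn_succ]
  congr 2
  · simp
  · funext i
    simp [Fin.succ_ne_zero]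

theorem encodeList_encodeSubset {n : ℕ} (E : List (Set (Fin n))) :
    encodeList encodeSubset E = (List.ofFn fun i : Fin E.length =>
      encodeSubset (insert 0 (Fin.succ '' E[i]))).flatten ++ [false] := by
  simp only [← cons_encodeSubset]
  rw [encodeList, List.flatMap_def]
  congr 2
  exact (List.ofFn_getElem_eq_map E fun S => true :: encodeSubset S).symm

theorem eq_encodeNat_append_iff {n : ℕ} {x y : List Bool} :
    x = encodeNat n ++ y ↔ Gen.head x = n ∧ Gen.rest x = false :: y := by
  constructor
  · rintro rfl
    exact ⟨head_encodeNat_append n y, rest_encodeNat_append n y⟩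
  · rintro ⟨rfl, h⟩
    have := eq_encodeNat_append (x := x) (by simp [h])
    rwa [h, List.tail_cons] at this

/-- The summand 2 counts the terminators of the number of vertices and of the list. The latter sits
where the marker of one more edge would be, hence the negated condition. -/
theorem eq_encodeHypergraph_iff {n : ℕ} {E : List (Set (Fin n))} {x : List Bool} :
    x = encodeHypergraph n E ↔ Gen.head x = n ∧
      (Gen.rest x).length = 2 + E.length * (n + 1) ∧ (∀ r < E.length, marker x r) ∧
      ¬ marker x E.length ∧ ∀ (r : Fin E.length) (c : Fin n), c ∈ E[r] ↔ incidence x r c := by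
  rw [encodeHypergraph, eq_encodeNat_append_iff, encodeList_encodeSubset]
  refine and_congr_right fun hn => ?_
  simp only [marker, incidence, hn]
  constructor
  · intro hx
    obtain ⟨hl, h⟩ := (flatten_ofFn_encodeSubset_eq_iff
      (N := fun i : Fin E.length => insert 0 (Fin.succ '' E[i]))).1 rfl
    set u := (List.ofFn fun i : Fin E.length =>
      encodeSubset (insert 0 (Fin.succ '' E[i]))).flatten with hu
    have hg : ∀ (r : Fin E.length) (j : Fin (n + 1)),
        (false :: (u ++ [false])).getD (1 + (r * (n + 1) + j)) false =
          u.getD (r * (n + 1) + j) false := by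
      intro r j
      rw [add_comm 1, List.getD_cons_succ, List.getD_append _ _ _ _
        (by rw [hl]; exact mul_add_lt r.2 j.2)]
    rw [hx]
    refine ⟨by simp [hl]; ring, fun r hr => ?_, ?_, fun r c => ?_⟩
    · have := hg ⟨r, hr⟩ 0
      simp only [Fin.val_zero, add_zero] at this
      rw [this]
      have := (h ⟨r, hr⟩ 0).1 (by simp)
      simpa using this
    · rw [add_comm 1, List.getD_cons_succ, List.getD_append_right _ _ _ _ hl.le, hl]
      simp
    · have h₁ := h r c.succ
      rw [← hg] at h₁
      rw [show 2 + ((r : ℕ) * (n + 1) + c) = 1 + (r * (n + 1) + c.succ) by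
        rw [Fin.val_succ]; ring, ← h₁]
      simp [Fin.succ_ne_zero]
  · rintro ⟨hl, h₁, h₂, h₃⟩
    have hne : Gen.rest x ≠ [] := by
      intro h0
      rw [h0, List.length_nil] at hl
      omega
    obtain ⟨y, hy⟩ : ∃ y, Gen.rest x = false :: y :=
      ⟨_, (eq_encodeNat_append_iff.1 (eq_encodeNat_append hne)).2⟩
    rw [hy] at hl h₁ h₂ h₃ ⊢
    rw [List.length_cons] at hl
    have ht : y.take (E.length * (n + 1)) = (List.ofFn fun i : Fin E.length =>
        encodeSubset (insert 0 (Fin.succ '' E[i]))).flatten := by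
      refine (flatten_ofFn_encodeSubset_eq_iff
        (N := fun i : Fin E.length => insert 0 (Fin.succ '' E[i]))).2
        ⟨by rw [List.length_take]; omega, fun r j => ?_⟩
      rw [List.getD_eq_getElem?_getD, List.getElem?_take_of_lt (mul_add_lt r.2 j.2),
        ← List.getD_eq_getElem?_getD]
      refine Fin.cases ?_ (fun c => ?_) j
      · have := h₁ r r.2
        rw [add_comm 1, List.getD_cons_succ] at this
        rw [List.getD_eq_getElem?_getD] at this
        simp [this]
      · have := h₃ r c
        rw [show 2 + ((r : ℕ) * (n + 1) + c) = (r * (n + 1) + c.succ) + 1 by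
          rw [Fin.val_succ]; ring, List.getD_cons_succ] at this
        rw [← this]
        simp [Fin.succ_ne_zero]
    have hd : y.drop (E.length * (n + 1)) = [false] := by
      rw [add_comm 1, List.getD_cons_succ, List.getD_eq_getElem _ _ (by omega),
        Bool.not_eq_true] at h₂
      rw [List.drop_eq_getElem_cons (by omega), h₂, List.drop_of_length_le (by omega)]
    rw [← ht, ← hd, List.take_append_drop]

/-- Covering sequences need no explicit distinctness: a repeated edge covers nothing new, so the
chosen list positions differ automatically. In the other direction distinctness is dropped. -/
theorem exists_coveringSeq_iff {n k : ℕ} {E : List (Set (Fin n))} {H : Hypergraph (Fin n)}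
    (hH : H.edgeSet = {e | e ∈ E}) {M : ℕ → ℕ → Prop}
    (hM : ∀ (r : Fin E.length) (c : Fin n), c ∈ E[r] ↔ M r c) :
    (∃ l, k ≤ l ∧ ∃ C : Fin l → Set (Fin n), IsCoveringSeq H C) ↔
      HasSeq k E.length n M M fun _ => True := by
  constructor
  · rintro ⟨l, hl, C, hC, h⟩
    have hC' : ∀ i, ∃ r : Fin E.length, E[r] = C i := by
      intro i
      have := hC i
      rw [hH] at this
      obtain ⟨r, hr, h⟩ := List.getElem_of_mem this
      exact ⟨⟨r, hr⟩, h⟩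
    choose ρ hρ using hC'
    choose γ hγ hγ' using h
    simp only [Set.mem_iUnion, not_exists] at hγ'
    refine ⟨fun i => if hi : i < l then ρ ⟨i, hi⟩ else 0,
      fun i => if hi : i < l then γ ⟨i, hi⟩ else 0, fun i hi => ?_⟩
    have hil : i < l := hi.trans_le hl
    simp only [dif_pos hil, Fin.is_lt, true_and]
    refine ⟨(hM _ _).1 (by rw [hρ]; exact hγ _), fun j hj => ?_⟩
    have hjl : j < l := hj.trans hil
    simp only [dif_pos hjl]
    refine ⟨fun h => hγ' ⟨i, hil⟩ ⟨j, hjl⟩ hj ?_, fun h => hγ' ⟨i, hil⟩ ⟨j, hjl⟩ hj ?_⟩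
    · rw [← hρ]
      exact (hM _ _).2 h
    · rw [← hρ, Fin.ext h, hρ]
      exact hγ _
  · rintro ⟨ρ, γ, h⟩
    refine ⟨k, le_rfl, fun i => E[ρ i]'(h i i.2).1, fun i => ?_, fun i => ?_⟩
    · rw [hH]
      exact List.getElem_mem _
    · refine ⟨⟨γ i, (h i i.2).2.1⟩, (hM ⟨ρ i, (h i i.2).1⟩ _).2 (h i i.2).2.2.2.1, ?_⟩
      simp only [Set.mem_iUnion, not_exists]
      exact fun j hj hmem => ((h i i.2).2.2.2.2 j hj).1 ((hM ⟨ρ j, (h j j.2).1⟩ _).1 hmem)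

theorem covering_iff_reduction (p : List Bool × ℕ) :
    p ∈ GrundyCoveringInHypergraphs ↔ hypergraphGen.reduction p ∈ WCS 3 3 := by
  rw [hypergraphGen_reduction]
  constructor
  · rintro ⟨n, H, E, -, hH, hx, hC⟩
    obtain ⟨rfl, hl, h₁, h₂, h₃⟩ := eq_encodeHypergraph_iff.1 hx
    exact ⟨E.length, hl, (exists_coveringSeq_iff hH h₃).1 hC, h₁, h₂⟩
  · rintro ⟨m, hl, hs, h₁, h₂⟩
    -- The list may repeat edges, which the encoding permits; the hypergraph takes the set of its
    -- entries.
    let E : List (Set (Fin (Gen.head p.1))) := List.ofFn fun r : Fin m => {c | incidence p.1 r c}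
    have hE : E.length = m := List.length_ofFn
    have hM : ∀ (r : Fin E.length) (c : Fin (Gen.head p.1)), c ∈ E[r] ↔ incidence p.1 r c := by
      intro r c
      simp [E]
    let H : Hypergraph (Fin (Gen.head p.1)) := ⟨Set.univ, {e | e ∈ E}, fun e _ => Set.subset_univ e⟩
    refine ⟨Gen.head p.1, H, E, rfl, rfl, ?_, (exists_coveringSeq_iff rfl hM).2 (hE ▸ hs)⟩
    exact eq_encodeHypergraph_iff.2 ⟨rfl, hE ▸ hl, hE ▸ h₁, hE ▸ h₂, hM⟩

theorem inW_grundyCoveringInHypergraphs : InW 3 GrundyCoveringInHypergraphs :=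
  ⟨3, by norm_num, Gen.fptReducible ok_hypergraphGen covering_iff_reduction⟩

end GrundyW

theorem mainTheorem6 :
    GrundyW.InW 3 GrundyW.GrundyDomination ∧
    GrundyW.InW 3 GrundyW.TotalGrundyDomination ∧
    GrundyW.InW 3 GrundyW.OneSidedGrundyTotalDomination ∧
    GrundyW.InW 3 GrundyW.LGrundyDomination ∧
    GrundyW.InW 3 GrundyW.ZGrundyDomination ∧
    GrundyW.InW 3 GrundyW.GrundyCoveringInHypergraphs :=
  ⟨GrundyW.inW_grundyDomination, GrundyW.inW_totalGrundyDomination,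
    GrundyW.inW_oneSidedGrundyTotalDomination, GrundyW.inW_lGrundyDomination,
    GrundyW.inW_zGrundyDomination, GrundyW.inW_grundyCoveringInHypergraphs⟩
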